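/- **Setting.** Let $\mathcal X$ be a finite-dimensional Euclidean space. For an operator $B$ on $\mathcal X$ let $\|B\|_{\rm op}$, $\|B\|_{\rm tr}$ be its spectral and nuclear norms; for self-adjoint positive definite $B$ put $\|x\|_B=\sqrt{\langle x,Bx\rangle}$. Let $\mathcal H$ be a linear space of self-adjoint operators on $\mathcal X$ such that $I\in\mathcal H$; $HFH\in\mathcal H$ for all $H,F\in\mathcal H$; and the orthogonal projection $\mathrm{proj}_{\mathcal H}$ (for the trace inner product) maps positive definite operators to positive definite operators. Define $$\mathcal R(x)=\Big\|\sqrt{\mathrm{proj}_{\mathcal H}(x\langle x,\cdot\rangle)}\Big\|_{\rm op},\qquad \mathcal R_*(x)=\Big\|\sqrt{\mathrm{proj}_{\mathcal H}(x\langle x,\cdot\rangle)}\Big\|_{\rm tr}.$$ Let $L,\Sigma,T\in\mathcal H$ be positive definite, and let $f:\mathcal X\to\mathbb R$ be continuously differentiable with differentiable gradient, such that for all $x,x'\in\mathcal X$ $$|f(x)-f(x')-\langle\nabla f(x'),x-x'\rangle|\le\tfrac12\|x-x'\|_L^2,$$ $$\|[\nabla^2f(x)-\nabla^2f(x')](x-x')\|_{T^{-1}}^2\le\|T\|_{\rm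 tr}^{-1}\|x-x'\|_T^4 .$$ Let $g(x;\xi)$, $\xi\sim\mathcal D$, satisfy $\mathbb E\,g(x;\xi)=\nabla f(x)$ and $\mathbb E\|g(x;\xi)-\nabla f(x)\|_{\Sigma^{-1}}^2\le\|\Sigma\|_{\rm tr}$ for all $x$. Let $D\in(0,\infty]$, $Q=\{x:\mathcal R(x)\le D\}$, let $f$ be bounded below on $Q$, $f^*=\inf_Q f$, $x_0\in Q$, $\Delta_0=f(x_0)-f^*$, and $$\mathcal G(x)=\tfrac1D\max_{x'\in Q}\langle\nabla f(x),x-x'\rangle\ \text{ if } D<\infty,\qquad \mathcal G(x)=\mathcal R_*(\nabla f(x))\ \text{ if } D=\infty .$$ **Algorithm** (parameters $\alpha,\beta,\eta$). Put $m_0=g(x_0;\xi_0)$ and, for $k\ge0$, $$x_{k+1}\in\arg\min\{\langle m_k,x-x_k\rangle:\ \mathcal R(x-(1-\beta)x_k)\le\eta\},$$ $$m_{k+1}=(1-\alpha)m_k+\alpha\, g(\bar x_{k+1};\xi_{k+1}),\qquad \bar x_{k+1}=x_k+\tfrac1\alpha(x_{k+1}-x_k),$$ with independent samples $\xi_k\sim\mathcal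 D$ ($\xi_{k+1}$ is independent of everything up to the choice of $x_{k+1}$; the minimizer may be any measurable choice). **Theorem.** There are universal constants $c_1,c_2,c_3,C,c_1',c_2',c_3',C'>0$ such that in every such setting and for every $\epsilon>0$ the following holds. 1. (Non-convex case.) Let $$\alpha=\min\Big\{1,\frac{c_1\epsilon^2}{\|\Sigma\|_{\rm tr}^2}\Big\},\quad \beta=\min\Big\{1,\frac{c_2\,\epsilon}{\|L\|_{\rm tr}D},\frac{c_3\sqrt\epsilon\,\alpha}{\sqrt{\|T\|_{\rm tr}}\,D}\Big\},\quad \eta=\beta D,$$ where for $D=\infty$ this means $\beta=0$ and $\eta=\min\{c_2\epsilon/\|L\|_{\rm tr},\,c_3\sqrt\epsilon\,\alpha/\sqrt{\|T\|_{\rm tr}}\}$. Then every integer $$K\ge C\max\Big\{1,\frac{\Delta_0}{\epsilon D},\frac{\|L\|_{\rm tr}\Delta_0}{\epsilon^2},\frac{\|\Sigma\|_{\rm tr}^3}{\epsilon^3},\frac{\|T\|_{\rm tr}^{1/2}\Delta_0}{\epsilon^{3/2}},\frac{\|\Sigma\|_{\rm tr}^2\|T\|_{\rm tr}^{1/2}\Delta_0}{\epsilon^{7/2}}\Big\}$$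 satisfies $\mathbb E\big[\min_{0\le k\le K-1}\mathcal G(x_k)\big]\le\epsilon$ (with $\Delta_0/(\epsilon D)=0$ if $D=\infty$). 2. (Convex case.) If moreover $f$ is convex, $D<\infty$, and $$\alpha=\min\Big\{1,\frac{c_1'\epsilon^2}{\|\Sigma\|_{\rm tr}^2D^2}\Big\},\quad \beta=\min\Big\{\alpha,\frac{c_2'\,\epsilon}{\|L\|_{\rm tr}D^2},\frac{c_3'\sqrt\epsilon\,\alpha}{\sqrt{\|T\|_{\rm tr}D^3}}\Big\},\quad \eta=\beta D,$$ then every integer $$K\ge C'\max\Big\{1,\frac{\|L\|_{\rm tr}D^2}{\epsilon},\frac{\|\Sigma\|_{\rm tr}^2D^2}{\epsilon^2},\frac{\|T\|_{\rm tr}^{1/2}D^{3/2}}{\epsilon^{1/2}},\frac{\|\Sigma\|_{\rm tr}^2\|T\|_{\rm tr}^{1/2}D^{7/2}}{\epsilon^{5/2}}\Big\}\cdot\log\Big(2+\frac{\Delta_0}{\epsilon}+\frac{\|\Sigma\|_{\rm tr}D}{\epsilon}\Big)$$ satisfies $\mathbb E[f(x_K)-f^*]\le\epsilon$. -/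

import Mathlib

open MeasureTheory ProbabilityTheory
open scoped ENNReal Gradient RealInnerProductSpace

namespace NonEuclideanSGD

noncomputable section

section Operators

variable {E : Type*} [NormedAddCommGroup E] [InnerProductSpace ℝ E] [FiniteDimensional ℝ E]

/-- Self-adjoint positive definite operators. -/
def IsPosDef (A : E →L[ℝ] E) : Prop :=
  IsSelfAdjoint A ∧ ∀ x : E, x ≠ 0 → 0 < ⟪x, A x⟫

/-- The weighted norm `‖x‖_B = √⟨x, B x⟩`. -/
def wnorm (B : E →L[ℝ] E) (x : E) : ℝ := √⟪x, B x⟫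

/-- The nuclear (trace) norm of an operator: the sum of its singular values. -/
def nuclearNorm (A : E →L[ℝ] E) : ℝ :=
  ∑ i ∈ Finset.range (Module.finrank ℝ E), (A : E →ₗ[ℝ] E).singularValues i

/-- The trace (Hilbert-Schmidt) inner product `⟨A, B⟩ = tr (A* B)` of operators. -/
def hsInner (A B : E →L[ℝ] E) : ℝ :=
  LinearMap.trace ℝ E ((ContinuousLinearMap.adjoint A ∘L B : E →L[ℝ] E) : E →ₗ[ℝ] E)

theorem hsInner_eq_sum (A B : E →L[ℝ] E) :
    hsInner A B = ∑ i, ⟪A (stdOrthonormalBasis ℝ E i), B (stdOrthonormalBasis ℝ E i)⟫ := by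
  rw [hsInner, LinearMap.trace_eq_sum_inner _ (stdOrthonormalBasis ℝ E)]
  refine Finset.sum_congr rfl fun i _ => ?_
  simp [ContinuousLinearMap.adjoint_inner_right]

theorem eq_zero_of_hsInner_self (A : E →L[ℝ] E) (h : hsInner A A = 0) : A = 0 := by
  rw [hsInner_eq_sum] at h
  have h2 := (Finset.sum_eq_zero_iff_of_nonneg (fun i _ => real_inner_self_nonneg)).1 h
  have h3 : (A : E →ₗ[ℝ] E) = 0 := by
    refine (stdOrthonormalBasis ℝ E).toBasis.ext fun i => ?_
    have := h2 i (Finset.mem_univ i)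
    rw [inner_self_eq_zero] at this
    simpa using this
  ext x
  exact congrArg (fun F : E →ₗ[ℝ] E => F x) h3

theorem hsInner_comm (A B : E →L[ℝ] E) : hsInner A B = hsInner B A := by
  simp only [hsInner_eq_sum]
  exact Finset.sum_congr rfl fun i _ => real_inner_comm _ _

theorem hsInner_add (A B C : E →L[ℝ] E) : hsInner A (B + C) = hsInner A B + hsInner A C := by
  simp [hsInner_eq_sum, inner_add_right, Finset.sum_add_distrib]

theorem hsInner_smul (c : ℝ) (A B : E →L[ℝ] E) : hsInner A (c • B) = c * hsInner A B := by
  simp [hsInner_eq_sum, inner_smul_right, Finset.mul_sum]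

theorem hsInner_sub (A B C : E →L[ℝ] E) : hsInner A (B - C) = hsInner A B - hsInner A C := by
  simp [hsInner_eq_sum, inner_sub_right, Finset.sum_sub_distrib]

/-- The trace inner product as a bilinear form. -/
def hsForm : (E →L[ℝ] E) →ₗ[ℝ] (E →L[ℝ] E) →ₗ[ℝ] ℝ :=
  LinearMap.mk₂ ℝ hsInner
    (fun A B C => by rw [hsInner_comm, hsInner_add, hsInner_comm C A, hsInner_comm C B])
    (fun c A B => by rw [hsInner_comm, hsInner_smul, hsInner_comm B A, smul_eq_mul])
    hsInner_add
    (fun c A B => by rw [hsInner_smul, smul_eq_mul])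

/-- Existence and uniqueness of the orthogonal projection, in the trace inner product, of an
operator onto a linear subspace of operators. -/
theorem existsUnique_hsProj (H : Submodule ℝ (E →L[ℝ] E)) (A : E →L[ℝ] E) :
    ∃! P : E →L[ℝ] E, P ∈ H ∧ ∀ F ∈ H, hsInner F (A - P) = 0 := by
  let ψ : H →ₗ[ℝ] Module.Dual ℝ H := (hsForm (E := E)).domRestrict₁₂ H H
  have hψ : ∀ G F : H, ψ G F = hsInner (G : E →L[ℝ] E) (F : E →L[ℝ] E) := fun G F => rfl
  have hinj : Function.Injective ψ := by
    rw [← LinearMap.ker_eq_bot, LinearMap.ker_eq_bot']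
    intro G hG
    have h0 : hsInner (G : E →L[ℝ] E) (G : E →L[ℝ] E) = 0 := by
      rw [← hψ, hG, LinearMap.zero_apply]
    exact Subtype.ext (eq_zero_of_hsInner_self _ h0)
  have hsurj : Function.Surjective ψ :=
    (LinearMap.injective_iff_surjective_of_finrank_eq_finrank
      (Subspace.dual_finrank_eq (K := ℝ) (V := H)).symm).1 hinj
  obtain ⟨P, hP⟩ := hsurj ((hsForm A).domRestrict H)
  have key : ∀ F ∈ H, hsInner (P : E →L[ℝ] E) F = hsInner A F := fun F hF => by
    rw [← hψ P ⟨F, hF⟩, hP]; rfl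
  refine ⟨P, ⟨P.2, fun F hF => ?_⟩, ?_⟩
  · rw [hsInner_sub, hsInner_comm F A, hsInner_comm F P, key F hF, sub_self]
  · rintro P' ⟨hP', h'⟩
    have hmem : P' - (P : E →L[ℝ] E) ∈ H := H.sub_mem hP' P.2
    have e1 := h' _ hmem
    have e2 := key _ hmem
    rw [hsInner_sub] at e1
    have hz : hsInner (P' - (P : E →L[ℝ] E)) (P' - (P : E →L[ℝ] E)) = 0 := by
      rw [hsInner_sub, hsInner_comm _ (P : E →L[ℝ] E), e2, hsInner_comm A]
      linarith
    exact sub_eq_zero.1 (eq_zero_of_hsInner_self _ hz)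

/-- The orthogonal projection of the operator `A` onto the space of operators `H`. -/
def hsProj (H : Submodule ℝ (E →L[ℝ] E)) (A : E →L[ℝ] E) : E →L[ℝ] E :=
  (existsUnique_hsProj H A).choose

open Classical in
/-- The positive semidefinite square root of a positive semidefinite operator: the operator with
the same orthonormal eigenvectors and the square roots of the eigenvalues. -/
def opSqrt (A : E →L[ℝ] E) : E →L[ℝ] E :=
  if hA : (A : E →ₗ[ℝ] E).IsSymmetric then
    ∑ i, √(hA.eigenvalues rfl i) •
      InnerProductSpace.rankOne ℝ (hA.eigenvectorBasis rfl i) (hA.eigenvectorBasis rfl i)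
  else 0

/-- The norm `R(x) = ‖√(proj_H (x⟨x,·⟩))‖_op`. -/
def primalNorm (H : Submodule ℝ (E →L[ℝ] E)) (x : E) : ℝ :=
  ‖opSqrt (hsProj H (InnerProductSpace.rankOne ℝ x x))‖

/-- The dual norm `R_*(x) = ‖√(proj_H (x⟨x,·⟩))‖_tr`. -/
def dualNorm (H : Submodule ℝ (E →L[ℝ] E)) (x : E) : ℝ :=
  nuclearNorm (opSqrt (hsProj H (InnerProductSpace.rankOne ℝ x x)))

/-- The structural conditions on the space of operators `H`. -/
structure IsStructured (H : Submodule ℝ (E →L[ℝ] E)) : Prop where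
  selfAdjoint : ∀ A ∈ H, IsSelfAdjoint A
  id_mem : ContinuousLinearMap.id ℝ E ∈ H
  conj_mem : ∀ A ∈ H, ∀ F ∈ H, A ∘L F ∘L A ∈ H
  proj_posDef : ∀ A : E →L[ℝ] E, IsPosDef A → IsPosDef (hsProj H A)

end Operators

section Objective

variable {E : Type*} [NormedAddCommGroup E] [InnerProductSpace ℝ E] [FiniteDimensional ℝ E]

/-- `f` is continuously differentiable and `1`-smooth with respect to `‖·‖_L`:
`|D_f(x; x')| ≤ ½ ‖x - x'‖²_L` for the Bregman divergence `D_f`. -/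
structure IsSmooth (f : E → ℝ) (L : E →L[ℝ] E) : Prop where
  contDiff : ContDiff ℝ 1 f
  bregman_le : ∀ x x' : E,
    |f x - f x' - ⟪∇ f x', x - x'⟫| ≤ 1 / 2 * wnorm L (x - x') ^ 2

/-- The Hessian `∇²f(x)`: the derivative of the gradient. -/
def hessian (f : E → ℝ) (x : E) : E →L[ℝ] E := fderiv ℝ (∇ f) x

/-- `f` is twice differentiable and second-order Lipschitz-smooth with respect to `‖·‖_T`. -/
structure IsSecondOrderSmooth (f : E → ℝ) (T : E →L[ℝ] E) : Prop where
  differentiable : Differentiable ℝ (∇ f)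
  hessian_le : ∀ x x' : E,
    wnorm (Ring.inverse T) ((hessian f x - hessian f x') (x - x')) ^ 2 ≤
      (nuclearNorm T)⁻¹ * wnorm T (x - x') ^ 4

/-- `g(·; ξ)` with `ξ ∼ 𝒟` is an unbiased estimator of `∇ f` whose noise
`n(x; ξ) = g(x; ξ) - ∇ f(x)` satisfies `𝔼 ‖n(x; ξ)‖²_{S⁻¹} ≤ ‖S‖_tr`. -/
structure IsGradientEstimator [MeasurableSpace E] {Ξ : Type*} [MeasurableSpace Ξ]
    (f : E → ℝ) (g : E → Ξ → E) (𝒟 : Measure Ξ) (S : E →L[ℝ] E) : Prop where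
  measurable : Measurable (Function.uncurry g)
  integrable : ∀ x, Integrable (g x) 𝒟
  unbiased : ∀ x, ∫ ξ, g x ξ ∂𝒟 = ∇ f x
  integrable_noise : ∀ x,
    Integrable (fun ξ => wnorm (Ring.inverse S) (g x ξ - ∇ f x) ^ 2) 𝒟
  variance_le : ∀ x,
    ∫ ξ, wnorm (Ring.inverse S) (g x ξ - ∇ f x) ^ 2 ∂𝒟 ≤ nuclearNorm S

/-- The constraint set `Q`: the ball of radius `D ∈ [0, ∞]` of the norm `R`. -/
def ball (H : Submodule ℝ (E →L[ℝ] E)) (D : ℝ≥0∞) : Set E :=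
  {x | ENNReal.ofReal (primalNorm H x) ≤ D}

/-- The optimal value `f*` of `f` over `Q`. -/
def optValue (H : Submodule ℝ (E →L[ℝ] E)) (D : ℝ≥0∞) (f : E → ℝ) : ℝ :=
  sInf (f '' ball H D)

open Classical in
/-- The convergence criterion: the Frank-Wolfe gap divided by `D` if `D < ∞`, and the dual norm of
the gradient if `D = ∞`. -/
def criterion (H : Submodule ℝ (E →L[ℝ] E)) (D : ℝ≥0∞) (f : E → ℝ) (x : E) : ℝ :=
  if D = ⊤ then dualNorm H (∇ f x)
  else 1 / D.toReal * sSup ((fun x' => ⟪∇ f x, x - x'⟫) '' ball H D)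

end Objective

section Algorithm

variable {E : Type*} [NormedAddCommGroup E] [InnerProductSpace ℝ E] [FiniteDimensional ℝ E]
  [MeasurableSpace E] {Ξ : Type*} [MeasurableSpace Ξ] {Ω : Type*} {mΩ : MeasurableSpace Ω}

/-- `(x_k)`, `(m_k)` is a run of non-Euclidean SGD with weight decay `β`, stepsize `η` and momentum
`α` with extrapolation, started at `x₀`. The fresh sample `ξ_{k+1} ∼ 𝒟` is independent of the
information `ℱ_k` that is available after `ξ_k` was drawn. The minimizer in the trust-region step
need not be unique; any (measurable) choice that depends only on this information is allowed. -/
structure IsRun (H : Submodule ℝ (E →L[ℝ] E)) (g : E → Ξ → E) (𝒟 : Measure Ξ)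
    (α β η : ℝ) (x₀ : E) (μ : Measure Ω) (ℱ : Filtration ℕ mΩ)
    (ξ : ℕ → Ω → Ξ) (x m : ℕ → Ω → E) : Prop where
  sample_measurable : ∀ k, Measurable[ℱ k] (ξ k)
  sample_law : ∀ k, μ.map (ξ k) = 𝒟
  sample_indep : ∀ k, Indep (MeasurableSpace.comap (ξ (k + 1)) inferInstance) (ℱ k) μ
  x_zero : ∀ ω, x 0 ω = x₀
  m_zero : ∀ ω, m 0 ω = g x₀ (ξ 0 ω)
  x_measurable : ∀ k, Measurable[ℱ k] (x (k + 1))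
  x_feasible : ∀ k ω, primalNorm H (x (k + 1) ω - (1 - β) • x k ω) ≤ η
  x_argmin : ∀ k ω, ∀ y : E, primalNorm H (y - (1 - β) • x k ω) ≤ η →
    ⟪m k ω, x (k + 1) ω - x k ω⟫ ≤ ⟪m k ω, y - x k ω⟫
  m_succ : ∀ k ω, m (k + 1) ω =
    (1 - α) • m k ω + α • g (x k ω + (1 / α) • (x (k + 1) ω - x k ω)) (ξ (k + 1) ω)

end Algorithm

section Parameters

/-! In this section `l`, `s`, `t` stand for the nuclear norms of the operators `L`, `Σ`, `T`. -/

/-- The momentum in the non-convex case: `min {1, c₁ ε² / s²}`. -/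
def momentum (c₁ ε s : ℝ) : ℝ := min 1 (c₁ * (ε ^ 2 / s ^ 2))

open Classical in
/-- The weight decay in the non-convex case:
`min {1, c₂ ε / (l D), c₃ √ε α / (√t D)}`, which is `0` if `D = ∞`. -/
def weightDecay (c₂ c₃ ε l t α : ℝ) (D : ℝ≥0∞) : ℝ :=
  if D = ⊤ then 0
  else min 1 (min (c₂ * (ε / (l * D.toReal))) (c₃ * (√ε * α / (√t * D.toReal))))

open Classical in
/-- The stepsize in the non-convex case: `η = β D` for the above weight decay `β`, and the limit
`min {c₂ ε / l, c₃ √ε α / √t}` of this expression if `D = ∞`. -/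
def stepsize (c₂ c₃ ε l t α : ℝ) (D : ℝ≥0∞) : ℝ :=
  if D = ⊤ then min (c₂ * (ε / l)) (c₃ * (√ε * α / √t))
  else weightDecay c₂ c₃ ε l t α D * D.toReal

open Classical in
/-- The iteration complexity in the non-convex case, up to a constant factor. The term
`Δ₀ / (ε D)` is `0` if `D = ∞`. -/
def complexity (ε l s t Δ₀ : ℝ) (D : ℝ≥0∞) : ℝ :=
  max 1 (max (if D = ⊤ then 0 else Δ₀ / (ε * D.toReal)) (max (l * Δ₀ / ε ^ 2)
    (max (s ^ 3 / ε ^ 3) (max (√t * Δ₀ / ε ^ (3 / 2 : ℝ)) (s ^ 2 * √t * Δ₀ / ε ^ (7 / 2 : ℝ))))))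

/-- The momentum in the convex case: `min {1, c₁ ε² / (s² D²)}`. -/
def momentumConvex (c₁ ε s D : ℝ) : ℝ := min 1 (c₁ * (ε ^ 2 / (s ^ 2 * D ^ 2)))

/-- The weight decay in the convex case: `min {α, c₂ ε / (l D²), c₃ √ε α / √(t D³)}`. -/
def weightDecayConvex (c₂ c₃ ε l t α D : ℝ) : ℝ :=
  min α (min (c₂ * (ε / (l * D ^ 2))) (c₃ * (√ε * α / √(t * D ^ 3))))

/-- The iteration complexity in the convex case, up to constant and logarithmic factors. -/
def complexityConvex (ε l s t D : ℝ) : ℝ :=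
  max 1 (max (l * D ^ 2 / ε) (max (s ^ 2 * D ^ 2 / ε ^ 2)
    (max (√t * D ^ (3 / 2 : ℝ) / √ε) (s ^ 2 * √t * D ^ (7 / 2 : ℝ) / ε ^ (5 / 2 : ℝ)))))

/-- The logarithmic factor in the convex case. -/
def logFactor (ε s Δ₀ D : ℝ) : ℝ := Real.log (2 + Δ₀ / ε + s * D / ε)

end Parameters

end

end NonEuclideanSGD

/-! Everything reduces to one trace inequality. Write `P_x` for the projection of `x⟨x,·⟩` onto `H`.
For positive semidefinite `B ∈ H`, `⟨x,Bx⟩ = tr(B P_x) ≤ ‖B‖_tr R(x)²`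
(`IsStructured.inner_apply_le`). So the weighted assumptions on `L`, `Σ`, `T` become smoothness and
noise bounds for the norm `R` and its dual, with trace norms as constants. That `R_*` is the dual of
`R` (`IsStructured.dualNorm_eq`) rests on `H` being closed under functions of a single positive
semidefinite element.

One step compares `x_{k+1}` with an arbitrary point of the trust region (`IsStructured.descent`).
The cost is `2η R_*(m_k - ∇f(x_k)) + 2‖L‖_tr η²`. A suitable comparison point produces `η 𝒢(x_k)` in
the non-convex case and a contraction by `1 - β` in the convex case.

The momentum error splits into averaged noise and bias. Fresh noise is orthogonal to the past in the
`Σ⁻¹` inner product, so the averaged noise has mean dual norm at most `‖Σ‖_tr ((1-α)^k + √α)`. The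
bias is of second order: `x_{k+1}` is the average of `x_k` and the extrapolated point with weights
`1-α` and `α`, so the Hessian terms cancel (`IsStructured.dualSup_extrapolation_le`). What remains
accumulates to at most `2‖T‖_tr η²/α²`.

Telescoping, or unrolling the contraction, gives explicit rates. The chosen `α, β, η` make each
stationary term a fixed fraction of `ε`, and the bound on `K` absorbs the initial terms. -/

namespace NonEuclideanSGD

set_option linter.unusedSectionVars false

/-! ### Operators diagonal in an orthonormal basis, and functional calculus inside `H`. -/

section DiagonalOperators

variable {E : Type*} [NormedAddCommGroup E] [InnerProductSpace ℝ E] [FiniteDimensional ℝ E]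

/-- The operator with eigenvectors `b i` and eigenvalues `d i`. -/
noncomputable def diagOp (b : OrthonormalBasis (Fin (Module.finrank ℝ E)) ℝ E)
    (d : Fin (Module.finrank ℝ E) → ℝ) : E →L[ℝ] E :=
  ∑ i, d i • InnerProductSpace.rankOne ℝ (b i) (b i)

variable (b : OrthonormalBasis (Fin (Module.finrank ℝ E)) ℝ E)
  (d e : Fin (Module.finrank ℝ E) → ℝ)

theorem diagOp_apply (x : E) : diagOp b d x = ∑ i, (d i * ⟪b i, x⟫) • b i := by
  simp [diagOp, mul_smul]

theorem diagOp_basis (i : Fin (Module.finrank ℝ E)) : diagOp b d (b i) = d i • b i := by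
  rw [diagOp_apply, Finset.sum_eq_single i]
  · simp
  · intro j _ hj
    simp [b.inner_eq_zero hj]
  · simp

theorem eq_diagOp {A : E →L[ℝ] E} (h : ∀ i, A (b i) = d i • b i) : A = diagOp b d := by
  have h3 : (A : E →ₗ[ℝ] E) = (diagOp b d : E →L[ℝ] E) := by
    refine b.toBasis.ext fun i => ?_
    simp [h i, diagOp_basis]
  ext x
  exact congrArg (fun F : E →ₗ[ℝ] E => F x) h3

theorem diagOp_comp : diagOp b d ∘L diagOp b e = diagOp b (fun i => d i * e i) := by
  refine eq_diagOp b _ fun i => ?_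
  simp [diagOp_basis, smul_smul, mul_comm]

theorem diagOp_one : diagOp b (fun _ => 1) = ContinuousLinearMap.id ℝ E :=
  (eq_diagOp b _ fun i => by simp).symm

theorem diagOp_isSelfAdjoint : IsSelfAdjoint (diagOp b d) := by
  rw [ContinuousLinearMap.isSelfAdjoint_iff_isSymmetric]
  intro x y
  simp only [ContinuousLinearMap.coe_coe, diagOp_apply, sum_inner, inner_sum, inner_smul_left,
    inner_smul_right]
  refine Finset.sum_congr rfl fun i _ => ?_
  simp [real_inner_comm x]
  ring

theorem diagOp_adjoint : ContinuousLinearMap.adjoint (diagOp b d) = diagOp b d :=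
  (diagOp_isSelfAdjoint b d)

theorem inner_diagOp (x y : E) : ⟪x, diagOp b d y⟫ = ⟪diagOp b d x, y⟫ := by
  rw [← ContinuousLinearMap.adjoint_inner_left, diagOp_adjoint]

theorem inner_diagOp_self (x : E) : ⟪x, diagOp b d x⟫ = ∑ i, d i * ⟪b i, x⟫ ^ 2 := by
  simp only [diagOp_apply, inner_sum, inner_smul_right]
  refine Finset.sum_congr rfl fun i _ => ?_
  rw [real_inner_comm x]
  ring

theorem norm_diagOp_le {c : ℝ} (hc : 0 ≤ c) (hd : ∀ i, |d i| ≤ c) : ‖diagOp b d‖ ≤ c := by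
  refine ContinuousLinearMap.opNorm_le_bound _ hc fun x => ?_
  refine le_of_sq_le_sq ?_ (by positivity)
  rw [← real_inner_self_eq_norm_sq, ← inner_diagOp, ← ContinuousLinearMap.comp_apply, diagOp_comp,
    inner_diagOp_self, mul_pow, ← b.sum_sq_norm_inner_right x, Finset.mul_sum]
  refine Finset.sum_le_sum fun i _ => ?_
  rw [Real.norm_eq_abs, sq_abs]
  gcongr
  rw [← abs_mul_abs_self, ← sq]
  exact pow_le_pow_left₀ (abs_nonneg _) (hd i) 2

theorem charpoly_diagOp : (diagOp b d : E →ₗ[ℝ] E).charpoly =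
    ∏ i, (Polynomial.X - Polynomial.C (d i)) := by
  rw [← LinearMap.charpoly_toMatrix _ b.toBasis]
  have : LinearMap.toMatrix b.toBasis b.toBasis (diagOp b d : E →ₗ[ℝ] E) = Matrix.diagonal d := by
    ext i j
    rw [LinearMap.toMatrix_apply]
    by_cases h : i = j
    · subst h
      simp [diagOp_basis]
    · simp [diagOp_basis, h]
  rw [this, Matrix.charpoly_diagonal]

/-- Singular values come as a sorted list while `d` is in arbitrary order. They are therefore
compared as multisets: both `d i ^ 2` and the eigenvalues of `A* A` are the roots of one
characteristic polynomial. -/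
theorem nuclearNorm_diagOp : nuclearNorm (diagOp b d) = ∑ i, |d i| := by
  have hsym := (LinearMap.isPositive_adjoint_comp_self (diagOp b d : E →ₗ[ℝ] E)).isSymmetric
  have hsq : LinearMap.adjoint (diagOp b d : E →ₗ[ℝ] E) ∘ₗ (diagOp b d : E →ₗ[ℝ] E) =
      (diagOp b (fun i => d i * d i) : E →L[ℝ] E) := by
    rw [← diagOp_comp]
    ext x
    simp only [LinearMap.comp_apply, ContinuousLinearMap.coe_coe, ContinuousLinearMap.comp_apply]
    exact congrArg (fun F : E →L[ℝ] E => F (diagOp b d x)) (diagOp_adjoint b d)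
  have hroots := hsym.roots_charpoly_eq_eigenvalues rfl
  have hcp : (LinearMap.adjoint (diagOp b d : E →ₗ[ℝ] E) ∘ₗ
      (diagOp b d : E →ₗ[ℝ] E)).charpoly = ∏ i, (Polynomial.X - Polynomial.C (d i * d i)) := by
    rw [hsq, charpoly_diagOp]
  rw [hcp, Polynomial.roots_prod _ _ (Finset.prod_ne_zero_iff.2
    fun i _ => Polynomial.X_sub_C_ne_zero _)] at hroots
  simp only [Polynomial.roots_X_sub_C, Multiset.bind_singleton] at hroots
  have h2 := congrArg (fun s : Multiset ℝ => (s.map Real.sqrt).sum) hroots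
  simp only [Multiset.map_map] at h2
  rw [nuclearNorm, Finset.sum_range]
  simp_rw [LinearMap.singularValues_fin _ rfl]
  calc _ = (Multiset.map (Real.sqrt ∘ (RCLike.ofReal : ℝ → ℝ) ∘ hsym.eigenvalues rfl)
        Finset.univ.val).sum := rfl
    _ = (Multiset.map (Real.sqrt ∘ fun i => d i * d i) Finset.univ.val).sum := h2.symm
    _ = ∑ i, √(d i * d i) := rfl
    _ = _ := by simp [Real.sqrt_mul_self_eq_abs]

/-- Puts an operator and its `opSqrt` in a common eigenbasis, so that later identities can be
checked entrywise on eigenvalues. -/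
theorem exists_eq_diagOp {A : E →L[ℝ] E} (hA : IsSelfAdjoint A) (hpos : ∀ x, 0 ≤ ⟪x, A x⟫) :
    ∃ (b : OrthonormalBasis (Fin (Module.finrank ℝ E)) ℝ E) (d : Fin (Module.finrank ℝ E) → ℝ),
      (∀ i, 0 ≤ d i) ∧ A = diagOp b d ∧ opSqrt A = diagOp b (fun i => √(d i)) := by
  have hsym : (A : E →ₗ[ℝ] E).IsSymmetric :=
    ContinuousLinearMap.isSelfAdjoint_iff_isSymmetric.1 hA
  have hap : ∀ i, A (hsym.eigenvectorBasis rfl i) =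
      hsym.eigenvalues rfl i • hsym.eigenvectorBasis rfl i :=
    fun i => hsym.apply_eigenvectorBasis rfl i
  refine ⟨hsym.eigenvectorBasis rfl, hsym.eigenvalues rfl, fun i => ?_, eq_diagOp _ _ hap, ?_⟩
  · have := hpos (hsym.eigenvectorBasis rfl i)
    rw [hap, inner_smul_right] at this
    simpa using this
  · rw [opSqrt, dif_pos hsym]
    rfl

theorem diagOp_eq_of_eq {p q : Fin (Module.finrank ℝ E) → ℝ} (h : ∀ i, p i = q i) :
    diagOp b p = diagOp b q := congrArg _ (funext h)

theorem diagOp_add : diagOp b (fun i => d i + e i) = diagOp b d + diagOp b e :=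
  (eq_diagOp b _ fun i => by simp [diagOp_basis, add_smul]).symm

variable {b d}

/-- Products of elements of `H` need not lie in `H`; only `A F A` is available. Hence the induction
climbs by two, `A^(k+2) = A A^k A`, starting from `I` and `A`. -/
theorem IsStructured.diagOp_pow_mem {H : Submodule ℝ (E →L[ℝ] E)} (hH : IsStructured H)
    (h : diagOp b d ∈ H) (n : ℕ) : diagOp b (fun i => d i ^ n) ∈ H := by
  induction n using Nat.strong_induction_on with
  | _ n ih =>
    match n with
    | 0 => simpa [diagOp_one] using hH.id_mem
    | 1 => simpa using h
    | k + 2 =>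
      have := hH.conj_mem _ h _ (ih k (by omega))
      rw [diagOp_comp, diagOp_comp] at this
      convert this using 2
      ext i
      ring

/-- On a finite spectrum every function agrees with its Lagrange interpolant, so `q(A)` is a
polynomial in `A`. No continuity of `q` is needed, which later admits pseudo-inverses. -/
theorem IsStructured.diagOp_comp_mem {H : Submodule ℝ (E →L[ℝ] E)} (hH : IsStructured H)
    (h : diagOp b d ∈ H) (q : ℝ → ℝ) : diagOp b (fun i => q (d i)) ∈ H := by
  classical
  set p := Lagrange.interpolate (Finset.univ.image d) id q
  have hp : ∀ i, p.eval (d i) = q (d i) := fun i =>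
    Lagrange.eval_interpolate_at_node q (Set.injOn_id _)
      (Finset.mem_image_of_mem d (Finset.mem_univ i))
  have : diagOp b (fun i => q (d i)) =
      ∑ k ∈ Finset.range (p.natDegree + 1), p.coeff k • diagOp b (fun i => d i ^ k) := by
    refine (eq_diagOp b _ fun i => ?_).symm
    rw [← hp, Polynomial.eval_eq_sum_range, Finset.sum_smul]
    simp [diagOp_basis, mul_smul]
  rw [this]
  exact Submodule.sum_mem _ fun k _ => H.smul_mem _ (hH.diagOp_pow_mem h k)

end DiagonalOperators

/-! ### The projection onto `H` and the norm `R`. -/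

section Projection

variable {E : Type*} [NormedAddCommGroup E] [InnerProductSpace ℝ E] [FiniteDimensional ℝ E]
  {H : Submodule ℝ (E →L[ℝ] E)}

theorem hsProj_mem (H : Submodule ℝ (E →L[ℝ] E)) (A : E →L[ℝ] E) : hsProj H A ∈ H :=
  (existsUnique_hsProj H A).choose_spec.1.1

theorem hsInner_hsProj {F : E →L[ℝ] E} (hF : F ∈ H) (A : E →L[ℝ] E) :
    hsInner F (hsProj H A) = hsInner F A := by
  have := (existsUnique_hsProj H A).choose_spec.1.2 F hF
  rw [hsInner_sub] at this
  exact (sub_eq_zero.1 this).symm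

theorem hsProj_eq {A P : E →L[ℝ] E} (hP : P ∈ H) (h : ∀ F ∈ H, hsInner F P = hsInner F A) :
    hsProj H A = P :=
  ((existsUnique_hsProj H A).choose_spec.2 P
    ⟨hP, fun F hF => by rw [hsInner_sub, h F hF, sub_self]⟩).symm

theorem hsProj_add (A B : E →L[ℝ] E) : hsProj H (A + B) = hsProj H A + hsProj H B :=
  hsProj_eq (H.add_mem (hsProj_mem H A) (hsProj_mem H B)) fun F hF => by
    rw [hsInner_add, hsInner_add, hsInner_hsProj hF, hsInner_hsProj hF]

theorem hsProj_smul (c : ℝ) (A : E →L[ℝ] E) : hsProj H (c • A) = c • hsProj H A :=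
  hsProj_eq (H.smul_mem c (hsProj_mem H A)) fun F hF => by
    rw [hsInner_smul, hsInner_smul, hsInner_hsProj hF]

theorem hsProj_of_mem {A : E →L[ℝ] E} (h : A ∈ H) : hsProj H A = A :=
  hsProj_eq h fun _ _ => rfl

theorem hsInner_diagOp (b : OrthonormalBasis (Fin (Module.finrank ℝ E)) ℝ E)
    (d : Fin (Module.finrank ℝ E) → ℝ) (A : E →L[ℝ] E) :
    hsInner (diagOp b d) A = ∑ i, d i * ⟪b i, A (b i)⟫ := by
  rw [hsInner, diagOp_adjoint, LinearMap.trace_eq_sum_inner _ b]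
  refine Finset.sum_congr rfl fun i _ => ?_
  simp [inner_diagOp, diagOp_basis, inner_smul_left]

theorem hsInner_rankOne (A : E →L[ℝ] E) (x : E) :
    hsInner A (InnerProductSpace.rankOne ℝ x x) = ⟪x, A x⟫ := by
  rw [hsInner_eq_sum]
  have := (stdOrthonormalBasis ℝ E).sum_inner_mul_inner (ContinuousLinearMap.adjoint A x) x
  rw [ContinuousLinearMap.adjoint_inner_left] at this
  rw [← this]
  refine Finset.sum_congr rfl fun i _ => ?_
  rw [InnerProductSpace.rankOne_apply, inner_smul_right, ContinuousLinearMap.adjoint_inner_left,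
    real_inner_comm x, mul_comm, real_inner_comm x]

/-- Cyclicity of the trace. -/
theorem hsInner_conj {A : E →L[ℝ] E} (hA : IsSelfAdjoint A) (F X : E →L[ℝ] E) :
    hsInner F (A ∘L X ∘L A) = hsInner (A ∘L F ∘L A) X := by
  have hA' : ContinuousLinearMap.adjoint A = A := hA
  simp only [hsInner, ContinuousLinearMap.adjoint_comp, hA']
  have := LinearMap.trace_mul_comm ℝ
    (((ContinuousLinearMap.adjoint F ∘L A ∘L X : E →L[ℝ] E)) : E →ₗ[ℝ] E) (A : E →ₗ[ℝ] E)
  exact this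

/-- Conjugation by `A` preserves `H` and is symmetric for the trace inner product, hence it commutes
with the orthogonal projection. -/
theorem IsStructured.hsProj_conj (hH : IsStructured H) {A : E →L[ℝ] E} (hA : A ∈ H)
    (X : E →L[ℝ] E) : hsProj H (A ∘L X ∘L A) = A ∘L hsProj H X ∘L A :=
  hsProj_eq (hH.conj_mem A hA _ (hsProj_mem H X)) fun F hF => by
    rw [hsInner_conj (hH.selfAdjoint A hA), hsInner_conj (hH.selfAdjoint A hA),
      hsInner_hsProj (hH.conj_mem A hA F hF)]

/-- Perturb `A` by a multiple of `I`, which the projection fixes, and let the multiple tend to zero.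
The multiple `δ / ‖v‖²` raises the quadratic form at `v` by exactly `δ`. -/
theorem IsStructured.inner_hsProj_nonneg (hH : IsStructured H) {A : E →L[ℝ] E}
    (hA : IsSelfAdjoint A) (hpos : ∀ x, 0 ≤ ⟪x, A x⟫) (v : E) : 0 ≤ ⟪v, hsProj H A v⟫ := by
  rcases eq_or_ne v 0 with rfl | hv
  · simp
  have key : ∀ δ : ℝ, 0 < δ → 0 ≤ ⟪v, hsProj H A v⟫ + δ := fun δ hδ => by
    have hv' : 0 < ‖v‖ ^ 2 := by positivity
    have hpd : IsPosDef (A + (δ / ‖v‖ ^ 2) • ContinuousLinearMap.id ℝ E) := by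
      refine ⟨hA.add ((IsSelfAdjoint.all _).smul (IsSelfAdjoint.one _)), fun x hx => ?_⟩
      have : 0 < ‖x‖ := norm_pos_iff.2 hx
      have := hpos x
      simp only [add_apply, inner_add_right, smul_apply,
        ContinuousLinearMap.id_apply, inner_smul_right, real_inner_self_eq_norm_sq]
      positivity
    have h := (hH.proj_posDef _ hpd).2 v hv
    rw [hsProj_add, hsProj_smul, hsProj_of_mem hH.id_mem] at h
    simp only [add_apply, inner_add_right, smul_apply,
      ContinuousLinearMap.id_apply, inner_smul_right, real_inner_self_eq_norm_sq] at h
    rw [div_mul_cancel₀ _ hv'.ne'] at h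
    exact h.le
  exact le_of_forall_pos_le_add key

/-- The projection of the rank-one operator `x⟨x,·⟩` onto `H`. -/
noncomputable def sqProj (H : Submodule ℝ (E →L[ℝ] E)) (x : E) : E →L[ℝ] E :=
  hsProj H (InnerProductSpace.rankOne ℝ x x)

theorem sqProj_mem (x : E) : sqProj H x ∈ H := hsProj_mem H _

theorem IsStructured.inner_sqProj_nonneg (hH : IsStructured H) (x v : E) :
    0 ≤ ⟪v, sqProj H x v⟫ := by
  refine hH.inner_hsProj_nonneg ?_ (fun y => ?_) v
  · rw [ContinuousLinearMap.isSelfAdjoint_iff_isSymmetric]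
    exact InnerProductSpace.isSymmetric_rankOne_self x
  · rw [InnerProductSpace.rankOne_apply, inner_smul_right, real_inner_comm]
    exact mul_self_nonneg _

theorem IsStructured.exists_sqProj_eq (hH : IsStructured H) (x : E) :
    ∃ (b : OrthonormalBasis (Fin (Module.finrank ℝ E)) ℝ E) (d : Fin (Module.finrank ℝ E) → ℝ),
      (∀ i, 0 ≤ d i) ∧ sqProj H x = diagOp b d ∧
        opSqrt (sqProj H x) = diagOp b (fun i => √(d i)) :=
  exists_eq_diagOp (hH.selfAdjoint _ (hsProj_mem H _)) (hH.inner_sqProj_nonneg x)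

theorem hsInner_sqProj {F : E →L[ℝ] E} (hF : F ∈ H) (x : E) :
    hsInner F (sqProj H x) = ⟪x, F x⟫ := by
  rw [sqProj, hsInner_hsProj hF, hsInner_rankOne]

/-- Both sides equal `tr(P_x P_v)`. The symmetry turns the form into a quadratic form in `x` for
fixed `v`, which makes `R` a norm. -/
theorem inner_sqProj_comm (x v : E) : ⟪v, sqProj H x v⟫ = ⟪x, sqProj H v x⟫ := by
  rw [← hsInner_sqProj (sqProj_mem x), hsInner_comm, hsInner_sqProj (sqProj_mem v)]

theorem sqProj_smul (c : ℝ) (x : E) : sqProj H (c • x) = c ^ 2 • sqProj H x := by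
  rw [sqProj, sqProj, ← hsProj_smul]
  congr 1
  ext y
  simp [smul_smul]
  ring_nf

theorem primalNorm_nonneg (x : E) : 0 ≤ primalNorm H x := norm_nonneg _

theorem IsStructured.primalNorm_sq (hH : IsStructured H) (x : E) :
    primalNorm H x ^ 2 = ‖sqProj H x‖ := by
  obtain ⟨b, d, hd, h1, h2⟩ := hH.exists_sqProj_eq x
  change ‖opSqrt (sqProj H x)‖ ^ 2 = _
  rw [h2, sq, ← ContinuousLinearMap.norm_adjoint_comp_self, diagOp_adjoint, diagOp_comp, h1]
  simp_rw [Real.mul_self_sqrt (hd _)]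

theorem IsStructured.inner_sqProj_le (hH : IsStructured H) (x v : E) :
    ⟪v, sqProj H x v⟫ ≤ primalNorm H x ^ 2 * ‖v‖ ^ 2 := by
  rw [hH.primalNorm_sq]
  refine (real_inner_le_norm _ _).trans ?_
  have := (sqProj H x).le_opNorm v
  nlinarith [norm_nonneg v]

theorem IsStructured.primalNorm_le (hH : IsStructured H) {x : E} {c : ℝ} (hc : 0 ≤ c)
    (h : ∀ v, ‖v‖ = 1 → ⟪v, sqProj H x v⟫ ≤ c ^ 2) : primalNorm H x ≤ c := by
  obtain ⟨b, d, hd, h1, h2⟩ := hH.exists_sqProj_eq x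
  change ‖opSqrt (sqProj H x)‖ ≤ _
  rw [h2]
  refine norm_diagOp_le b _ hc fun i => ?_
  rw [abs_of_nonneg (Real.sqrt_nonneg _)]
  refine Real.sqrt_le_iff.2 ⟨hc, ?_⟩
  have := h (b i) (b.norm_eq_one i)
  rw [h1, diagOp_basis, inner_smul_right] at this
  simpa using this

/-- By symmetry `⟨v, P_x v⟩ = ‖√P_v x‖²`, so `R(x)` is the supremum over unit `v` of the seminorms
`‖√P_v x‖`. -/
theorem IsStructured.primalNorm_add_le (hH : IsStructured H) (x y : E) :
    primalNorm H (x + y) ≤ primalNorm H x + primalNorm H y := by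
  refine hH.primalNorm_le (add_nonneg (primalNorm_nonneg x) (primalNorm_nonneg y)) fun v hv => ?_
  obtain ⟨b, d, hd, h1, -⟩ := hH.exists_sqProj_eq v
  set B := diagOp b (fun i => √(d i)) with hB
  have hBB : ∀ z, ‖B z‖ ^ 2 = ⟪z, sqProj H v z⟫ := fun z => by
    rw [← real_inner_self_eq_norm_sq, hB, ← inner_diagOp, ← ContinuousLinearMap.comp_apply,
      diagOp_comp, h1]
    simp_rw [Real.mul_self_sqrt (hd _)]
  have hle : ∀ z, ‖B z‖ ≤ primalNorm H z := fun z => by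
    refine le_of_sq_le_sq ?_ (primalNorm_nonneg z)
    have := hH.inner_sqProj_le z v
    rw [inner_sqProj_comm, hv] at this
    rw [hBB]
    linarith
  rw [inner_sqProj_comm, ← hBB, map_add]
  exact pow_le_pow_left₀ (norm_nonneg _)
    ((norm_add_le _ _).trans (add_le_add (hle x) (hle y))) 2

theorem IsStructured.primalNorm_smul (hH : IsStructured H) (c : ℝ) (x : E) :
    primalNorm H (c • x) = |c| * primalNorm H x := by
  have : primalNorm H (c • x) ^ 2 = (|c| * primalNorm H x) ^ 2 := by
    rw [hH.primalNorm_sq, sqProj_smul, norm_smul, mul_pow, hH.primalNorm_sq, sq_abs]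
    simp
  exact (pow_left_inj₀ (primalNorm_nonneg _)
    (mul_nonneg (abs_nonneg _) (primalNorm_nonneg _)) two_ne_zero).1 this

theorem IsStructured.primalNorm_neg (hH : IsStructured H) (x : E) :
    primalNorm H (-x) = primalNorm H x := by
  have := hH.primalNorm_smul (-1) x
  simpa using this

theorem IsStructured.primalNorm_sub_le (hH : IsStructured H) (x y : E) :
    primalNorm H (x - y) ≤ primalNorm H x + primalNorm H y := by
  rw [sub_eq_add_neg, ← hH.primalNorm_neg y]
  exact hH.primalNorm_add_le _ _

theorem IsStructured.primalNorm_zero (hH : IsStructured H) : primalNorm H (0 : E) = 0 := by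
  have := hH.primalNorm_smul 0 0
  simpa using this

/-- Since `B ∈ H`, `⟨x,Bx⟩ = tr(B P_x)`; in an eigenbasis of `B` each diagonal entry of `P_x` is at
most `R(x)²`. -/
theorem IsStructured.inner_apply_le (hH : IsStructured H) {B : E →L[ℝ] E} (hB : B ∈ H)
    (hpos : ∀ x, 0 ≤ ⟪x, B x⟫) (x : E) : ⟪x, B x⟫ ≤ nuclearNorm B * primalNorm H x ^ 2 := by
  obtain ⟨b, d, hd, h1, -⟩ := exists_eq_diagOp (hH.selfAdjoint B hB) hpos
  rw [← hsInner_sqProj hB, h1, hsInner_diagOp, nuclearNorm_diagOp, Finset.sum_mul]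
  refine Finset.sum_le_sum fun i _ => ?_
  rw [abs_of_nonneg (hd i)]
  refine mul_le_mul_of_nonneg_left ?_ (hd i)
  simpa [b.norm_eq_one i] using hH.inner_sqProj_le x (b i)

theorem IsPosDef.inner_nonneg {B : E →L[ℝ] E} (hB : IsPosDef B) (x : E) : 0 ≤ ⟪x, B x⟫ := by
  rcases eq_or_ne x 0 with rfl | h
  · simp
  · exact (hB.2 x h).le

theorem nuclearNorm_nonneg (A : E →L[ℝ] E) : 0 ≤ nuclearNorm A :=
  Finset.sum_nonneg fun i _ => LinearMap.singularValues_nonneg _ i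

/-- `V = B^(1/2)` and `W = B^(-1/2)`. They turn weighted norms into Euclidean norms of linear
images, so that the triangle and Cauchy–Schwarz inequalities apply. -/
theorem IsPosDef.exists_sqrt {B : E →L[ℝ] E} (hB : IsPosDef B) :
    ∃ V W : E →L[ℝ] E, (∀ x, wnorm B x = ‖V x‖) ∧ (∀ x, wnorm (Ring.inverse B) x = ‖W x‖) ∧
      ∀ x y, ⟪x, y⟫ = ⟪W x, V y⟫ := by
  obtain ⟨b, d, hd, h1, -⟩ := exists_eq_diagOp hB.1 hB.inner_nonneg
  have hd' : ∀ i, 0 < d i := fun i => by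
    have := hB.2 (b i) (fun h => by simpa [h] using b.norm_eq_one i)
    rw [h1, diagOp_basis, inner_smul_right] at this
    simpa using this
  have hinv : Ring.inverse B = diagOp b (fun i => (d i)⁻¹) := by
    rw [h1]
    exact Ring.inverse_unit (⟨diagOp b d, diagOp b (fun i => (d i)⁻¹),
      (diagOp_comp b _ _).trans ((diagOp_eq_of_eq b fun i =>
        mul_inv_cancel₀ (hd' i).ne').trans (diagOp_one b)),
      (diagOp_comp b _ _).trans ((diagOp_eq_of_eq b fun i =>
        inv_mul_cancel₀ (hd' i).ne').trans (diagOp_one b))⟩ : (E →L[ℝ] E)ˣ)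
  have hw : ∀ (e q : Fin (Module.finrank ℝ E) → ℝ) (x : E), (∀ i, q i * q i = e i) →
      wnorm (diagOp b e) x = ‖diagOp b q x‖ := fun e q x h => by
    rw [wnorm, ← Real.sqrt_sq (norm_nonneg (diagOp b q x)), ← real_inner_self_eq_norm_sq,
      ← inner_diagOp, ← ContinuousLinearMap.comp_apply, diagOp_comp]
    simp_rw [h]
  refine ⟨diagOp b (fun i => √(d i)), diagOp b (fun i => (√(d i))⁻¹), fun x => ?_, fun x => ?_,
    fun x y => ?_⟩
  · rw [h1]
    exact hw _ _ x fun i => Real.mul_self_sqrt (hd i)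
  · rw [hinv]
    refine hw _ _ x fun i => ?_
    rw [← mul_inv, Real.mul_self_sqrt (hd i)]
  · rw [← inner_diagOp, ← ContinuousLinearMap.comp_apply, diagOp_comp,
      diagOp_eq_of_eq b (q := fun _ => 1) fun i => inv_mul_cancel₀ (Real.sqrt_pos.2 (hd' i)).ne',
      diagOp_one]
    rfl

theorem IsPosDef.nuclearNorm_pos [Nontrivial E] {B : E →L[ℝ] E} (hB : IsPosDef B) :
    0 < nuclearNorm B := by
  obtain ⟨b, d, hd, h1, -⟩ := exists_eq_diagOp hB.1 hB.inner_nonneg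
  have hd' : ∀ i, 0 < d i := fun i => by
    have := hB.2 (b i) (fun h => by simpa [h] using b.norm_eq_one i)
    rw [h1, diagOp_basis, inner_smul_right] at this
    simpa using this
  rw [h1, nuclearNorm_diagOp]
  have : Nonempty (Fin (Module.finrank ℝ E)) := ⟨⟨0, Module.finrank_pos⟩⟩
  exact Finset.sum_pos (fun i _ => abs_pos.2 (hd' i).ne') Finset.univ_nonempty

end Projection

/-! ### The dual norm of `R`, its identification with `R_*`, and the criterion. -/

section DualNorm

variable {E : Type*} [NormedAddCommGroup E] [InnerProductSpace ℝ E] [FiniteDimensional ℝ E]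
  {H : Submodule ℝ (E →L[ℝ] E)}

/-- The dual of the norm `R`, as a support function. -/
noncomputable def dualSup (H : Submodule ℝ (E →L[ℝ] E)) (v : E) : ℝ :=
  sSup ((fun y => ⟪v, y⟫) '' {y | primalNorm H y ≤ 1})

theorem IsStructured.norm_le (hH : IsStructured H) (x : E) :
    ‖x‖ ≤ √(nuclearNorm (ContinuousLinearMap.id ℝ E)) * primalNorm H x := by
  refine le_of_sq_le_sq ?_ (mul_nonneg (Real.sqrt_nonneg _) (primalNorm_nonneg x))
  rw [mul_pow, Real.sq_sqrt (nuclearNorm_nonneg _), ← real_inner_self_eq_norm_sq]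
  exact hH.inner_apply_le hH.id_mem (fun x => real_inner_self_nonneg) x

theorem IsStructured.bddAbove_inner (hH : IsStructured H) (v : E) :
    BddAbove ((fun y => ⟪v, y⟫) '' {y | primalNorm H y ≤ 1}) := by
  refine ⟨‖v‖ * √(nuclearNorm (ContinuousLinearMap.id ℝ E)), ?_⟩
  rintro _ ⟨y, hy, rfl⟩
  refine (real_inner_le_norm v y).trans ?_
  gcongr
  exact (hH.norm_le y).trans (mul_le_of_le_one_right (Real.sqrt_nonneg _) hy)

theorem IsStructured.dualSup_le (hH : IsStructured H) {v : E} {c : ℝ}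
    (h : ∀ y, primalNorm H y ≤ 1 → ⟪v, y⟫ ≤ c) : dualSup H v ≤ c := by
  refine csSup_le ⟨0, 0, ?_, by simp⟩ ?_
  · simp [hH.primalNorm_zero]
  · rintro _ ⟨y, hy, rfl⟩
    exact h y hy

theorem IsStructured.le_dualSup (hH : IsStructured H) (v : E) {y : E} (hy : primalNorm H y ≤ 1) :
    ⟪v, y⟫ ≤ dualSup H v :=
  le_csSup (hH.bddAbove_inner v) ⟨y, hy, rfl⟩

theorem IsStructured.dualSup_nonneg (hH : IsStructured H) (v : E) : 0 ≤ dualSup H v := by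
  have := hH.le_dualSup v (y := 0) (by simp [hH.primalNorm_zero])
  simpa using this

theorem IsStructured.inner_le (hH : IsStructured H) (v y : E) :
    ⟪v, y⟫ ≤ dualSup H v * primalNorm H y := by
  rcases (primalNorm_nonneg (H := H) y).eq_or_lt with h | h
  · have := hH.norm_le y
    rw [← h, mul_zero] at this
    rw [norm_le_zero_iff.1 this, inner_zero_right, hH.primalNorm_zero, mul_zero]
  · have := hH.le_dualSup v (y := (primalNorm H y)⁻¹ • y) (by
      rw [hH.primalNorm_smul, abs_of_pos (inv_pos.2 h), inv_mul_cancel₀ h.ne'])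
    rw [inner_smul_right, inv_mul_le_iff₀ h] at this
    linarith

theorem IsStructured.dualSup_add_le (hH : IsStructured H) (v w : E) :
    dualSup H (v + w) ≤ dualSup H v + dualSup H w :=
  hH.dualSup_le fun y hy => by
    rw [inner_add_left]
    exact add_le_add (hH.le_dualSup v hy) (hH.le_dualSup w hy)

theorem IsStructured.dualSup_smul_le (hH : IsStructured H) (c : ℝ) (v : E) :
    dualSup H (c • v) ≤ |c| * dualSup H v :=
  hH.dualSup_le fun y hy => by
    have : ⟪c • v, y⟫ = ⟪v, c • y⟫ := by rw [inner_smul_left, inner_smul_right]; rfl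
    rw [this]
    refine (hH.inner_le v _).trans ?_
    rw [hH.primalNorm_smul, mul_comm]
    exact mul_le_mul_of_nonneg_right (mul_le_of_le_one_right (abs_nonneg c) hy)
      (hH.dualSup_nonneg v)

theorem IsStructured.dualSup_zero (hH : IsStructured H) : dualSup H (0 : E) = 0 :=
  le_antisymm (hH.dualSup_le fun y _ => by simp) (hH.dualSup_nonneg 0)

theorem IsStructured.wnorm_le (hH : IsStructured H) {B : E →L[ℝ] E} (hB : B ∈ H)
    (hpos : IsPosDef B) (x : E) : wnorm B x ≤ √(nuclearNorm B) * primalNorm H x := by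
  rw [wnorm, ← Real.sqrt_sq (primalNorm_nonneg x), ← Real.sqrt_mul (nuclearNorm_nonneg B)]
  exact Real.sqrt_le_sqrt (hH.inner_apply_le hB hpos.inner_nonneg x)

theorem wnorm_nonneg (B : E →L[ℝ] E) (x : E) : 0 ≤ wnorm B x := Real.sqrt_nonneg _

/-- Dual form of the trace inequality: Cauchy–Schwarz `⟨x,y⟩ ≤ ‖x‖_{B⁻¹} ‖y‖_B`, where `‖y‖_B ≤
√‖B‖_tr` on the unit ball of `R`. -/
theorem IsStructured.dualSup_le_wnorm (hH : IsStructured H) {B : E →L[ℝ] E} (hB : B ∈ H)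
    (hpos : IsPosDef B) (x : E) :
    dualSup H x ≤ √(nuclearNorm B) * wnorm (Ring.inverse B) x := by
  obtain ⟨V, W, hV, hW, hVW⟩ := hpos.exists_sqrt
  refine hH.dualSup_le fun y hy => ?_
  rw [hVW, mul_comm, hW]
  refine (real_inner_le_norm _ _).trans (mul_le_mul_of_nonneg_left ?_ (norm_nonneg _))
  rw [← hV]
  exact (hH.wnorm_le hB hpos y).trans (mul_le_of_le_one_right (Real.sqrt_nonneg _) hy)

theorem IsStructured.dualSup_le_norm (hH : IsStructured H) (x : E) :
    dualSup H x ≤ √(nuclearNorm (ContinuousLinearMap.id ℝ E)) * ‖x‖ :=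
  hH.dualSup_le fun y hy => by
    rw [mul_comm]
    refine (real_inner_le_norm x y).trans ?_
    gcongr
    exact (hH.norm_le y).trans (mul_le_of_le_one_right (Real.sqrt_nonneg _) hy)

theorem IsStructured.continuous_dualSup (hH : IsStructured H) :
    Continuous (dualSup H : E → ℝ) := by
  set κ := √(nuclearNorm (ContinuousLinearMap.id ℝ E))
  have h : ∀ v w : E, dualSup H v ≤ dualSup H w + κ * dist v w := fun v w => by
    have h1 := hH.dualSup_add_le w (v - w)
    have h2 := hH.dualSup_le_norm (v - w)
    rw [add_sub_cancel] at h1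
    rw [dist_eq_norm]
    exact h1.trans (add_le_add_right h2 _)
  exact (LipschitzWith.of_le_add_mul ⟨κ, Real.sqrt_nonneg _⟩ h).continuous

theorem sqProj_apply_eq_comp (hH : IsStructured H) {A : E →L[ℝ] E} (hA : A ∈ H) (x : E) :
    sqProj H (A x) = A ∘L sqProj H x ∘L A := by
  rw [sqProj, sqProj, ← hH.hsProj_conj hA]
  congr 1
  ext y
  have hA' : ContinuousLinearMap.adjoint A = A := hH.selfAdjoint A hA
  simp only [InnerProductSpace.rankOne_apply, ContinuousLinearMap.comp_apply, map_smul]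
  rw [← ContinuousLinearMap.adjoint_inner_right, hA']

/-- With `P = P_x`, the supremum is attained at `y = P^(-1/2) x`: `P_y` is the projection onto the
range of `P`, so `R(y) ≤ 1`, and `⟨x,y⟩ = tr √P`. Conversely `⟨x,y⟩ = ⟨P^(-1/4) x, P^(1/4) y⟩`, and
both factors have squared norm at most `tr √P`. -/
theorem IsStructured.dualNorm_eq (hH : IsStructured H) (x : E) : dualNorm H x = dualSup H x := by
  obtain ⟨b, d, hd, h1, h2⟩ := hH.exists_sqProj_eq x
  have hP : diagOp b d ∈ H := h1 ▸ hsProj_mem H _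
  have hN : dualNorm H x = ∑ i, √(d i) := by
    change nuclearNorm (opSqrt (sqProj H x)) = _
    rw [h2, nuclearNorm_diagOp]
    exact Finset.sum_congr rfl fun i _ => abs_of_nonneg (Real.sqrt_nonneg _)
  -- `q(P)` lies in `H`, so `⟨x, q(P) x⟩ = tr(q(P) P)` depends on the eigenvalues alone.
  have hin : ∀ q : ℝ → ℝ, ⟪x, diagOp b (fun i => q (d i)) x⟫ = ∑ i, q (d i) * d i := fun q => by
    rw [← hsInner_sqProj (hH.diagOp_comp_mem hP q), hsInner_diagOp, h1]
    refine Finset.sum_congr rfl fun i _ => ?_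
    simp [diagOp_basis, inner_smul_right]
  -- The convention `0⁻¹ = 0` makes `(√·)⁻¹` the pseudo-inverse, so zero eigenvalues do no harm.
  have hinv : ∀ i, (√(d i))⁻¹ * d i = √(d i) := fun i => by
    rcases eq_or_ne (√(d i)) 0 with h | h
    · simp [h]
    · rw [inv_mul_eq_iff_eq_mul₀ h, Real.mul_self_sqrt (hd i)]
  rw [hN]
  apply le_antisymm
  · have hA := hH.diagOp_comp_mem hP (fun a => (√a)⁻¹)
    have hR : primalNorm H (diagOp b (fun i => (√(d i))⁻¹) x) ≤ 1 := by
      refine (sq_le_one_iff₀ (primalNorm_nonneg _)).1 ?_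
      rw [hH.primalNorm_sq, sqProj_apply_eq_comp hH hA, h1, diagOp_comp, diagOp_comp]
      refine norm_diagOp_le _ _ zero_le_one fun i => ?_
      rw [mul_comm (d i), hinv]
      rcases eq_or_ne (√(d i)) 0 with h | h
      · simp [h]
      · simp [inv_mul_cancel₀ h]
    have := hH.le_dualSup x hR
    rw [hin (fun a => (√a)⁻¹)] at this
    simpa only [hinv] using this
  · refine hH.dualSup_le fun y hy => ?_
    -- The operator is the projection onto the kernel of `P`. Its value at `x` vanishes because its
    -- squared norm is the trace of that projection times `P`; hence `x` lies in the range of `P`.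
    have hZ : diagOp b (fun i => 1 - √√(d i) * (√√(d i))⁻¹) x = 0 := by
      rw [← norm_eq_zero, ← sq_eq_zero_iff, ← real_inner_self_eq_norm_sq, ← inner_diagOp,
        ← ContinuousLinearMap.comp_apply, diagOp_comp,
        hin (fun a => (1 - √√a * (√√a)⁻¹) * (1 - √√a * (√√a)⁻¹))]
      refine Finset.sum_eq_zero fun i _ => ?_
      rcases (hd i).eq_or_lt with h | h
      · simp [← h]
      · have : √√(d i) ≠ 0 := (Real.sqrt_pos.2 (Real.sqrt_pos.2 h)).ne'
        simp [mul_inv_cancel₀ this]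
    have hx : diagOp b (fun i => √√(d i)) (diagOp b (fun i => (√√(d i))⁻¹) x) = x := by
      rw [← ContinuousLinearMap.comp_apply, diagOp_comp]
      have h := congrArg (fun F : E →L[ℝ] E => F x) (diagOp_add b
        (fun i => 1 - √√(d i) * (√√(d i))⁻¹) (fun i => √√(d i) * (√√(d i))⁻¹))
      simpa [hZ, diagOp_one] using h.symm
    have e1 : ‖diagOp b (fun i => (√√(d i))⁻¹) x‖ ^ 2 = ∑ i, √(d i) := by
      rw [← real_inner_self_eq_norm_sq, ← inner_diagOp, ← ContinuousLinearMap.comp_apply,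
        diagOp_comp, hin (fun a => (√√a)⁻¹ * (√√a)⁻¹)]
      refine Finset.sum_congr rfl fun i _ => ?_
      rw [← mul_inv, Real.mul_self_sqrt (Real.sqrt_nonneg _), hinv]
    have e2 : ‖diagOp b (fun i => √√(d i)) y‖ ^ 2 ≤ ∑ i, √(d i) := by
      have hpos : ∀ z, 0 ≤ ⟪z, diagOp b (fun i => √(d i)) z⟫ := fun z => by
        rw [inner_diagOp_self]
        exact Finset.sum_nonneg fun i _ => mul_nonneg (Real.sqrt_nonneg _) (sq_nonneg _)
      have := hH.inner_apply_le (hH.diagOp_comp_mem hP Real.sqrt) hpos y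
      rw [← real_inner_self_eq_norm_sq, ← inner_diagOp, ← ContinuousLinearMap.comp_apply,
        diagOp_comp]
      simp_rw [Real.mul_self_sqrt (Real.sqrt_nonneg _)]
      refine this.trans ((mul_le_of_le_one_right (nuclearNorm_nonneg _)
        (pow_le_one₀ (primalNorm_nonneg _) hy)).trans (le_of_eq ?_))
      rw [nuclearNorm_diagOp]
      exact Finset.sum_congr rfl fun i _ => abs_of_nonneg (Real.sqrt_nonneg _)
    calc ⟪x, y⟫ = ⟪diagOp b (fun i => (√√(d i))⁻¹) x, diagOp b (fun i => √√(d i)) y⟫ := by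
          rw [inner_diagOp, hx]
      _ ≤ ‖diagOp b (fun i => (√√(d i))⁻¹) x‖ * ‖diagOp b (fun i => √√(d i)) y‖ :=
          real_inner_le_norm _ _
      _ ≤ ∑ i, √(d i) := by
          nlinarith [sq_nonneg (‖diagOp b (fun i => (√√(d i))⁻¹) x‖ -
            ‖diagOp b (fun i => √√(d i)) y‖)]

theorem mem_ball_iff {D : ℝ≥0∞} (hD : D ≠ ⊤) (x : E) :
    x ∈ ball H D ↔ primalNorm H x ≤ D.toReal :=
  ENNReal.ofReal_le_iff_le_toReal hD

/-- The maximum over `Q` is a support function, which yields a closed form whose continuity in `x`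
is visible. -/
theorem IsStructured.criterion_eq (hH : IsStructured H) {D : ℝ≥0∞} (hD0 : 0 < D) (hD : D ≠ ⊤)
    (f : E → ℝ) (x : E) :
    criterion H D f x = 1 / D.toReal * (⟪∇ f x, x⟫ + D.toReal * dualSup H (∇ f x)) := by
  have hD' : 0 < D.toReal := ENNReal.toReal_pos hD0.ne' hD
  rw [criterion, if_neg hD]
  congr 1
  have hup : ∀ z ∈ (fun x' => ⟪∇ f x, x - x'⟫) '' ball H D,
      z ≤ ⟪∇ f x, x⟫ + D.toReal * dualSup H (∇ f x) := by
    rintro _ ⟨y, hy, rfl⟩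
    have h1 := hH.inner_le (∇ f x) (-y)
    rw [hH.primalNorm_neg, inner_neg_right] at h1
    have h2 := mul_le_mul_of_nonneg_left ((mem_ball_iff hD y).1 hy) (hH.dualSup_nonneg (∇ f x))
    simp only [inner_sub_right]
    linarith
  apply le_antisymm
  · exact csSup_le ⟨_, 0, (mem_ball_iff hD 0).2 (by rw [hH.primalNorm_zero]; exact hD'.le), rfl⟩ hup
  · rw [← le_sub_iff_add_le', ← le_div_iff₀' hD']
    refine hH.dualSup_le fun y hy => ?_
    rw [le_div_iff₀' hD', le_sub_iff_add_le']
    refine le_csSup ⟨_, hup⟩ ⟨-(D.toReal • y), (mem_ball_iff hD _).2 ?_, ?_⟩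
    · rw [hH.primalNorm_neg, hH.primalNorm_smul, abs_of_pos hD']
      exact mul_le_of_le_one_right hD'.le hy
    · simp [inner_add_right, inner_smul_right]

theorem IsStructured.continuous_criterion (hH : IsStructured H) {D : ℝ≥0∞} (hD0 : 0 < D)
    {f : E → ℝ} (hf : Continuous (∇ f)) : Continuous (criterion H D f) := by
  by_cases hD : D = ⊤
  · have : criterion H D f = fun x => dualSup H (∇ f x) := by
      ext x
      rw [criterion, if_pos hD, hH.dualNorm_eq]
    rw [this]
    exact hH.continuous_dualSup.comp hf
  · have : criterion H D f = _ := funext fun x => hH.criterion_eq hD0 hD f x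
    rw [this]
    have := hH.continuous_dualSup.comp hf
    simp only [Function.comp_def] at this
    fun_prop

end DualNorm

/-! ### Second-order Taylor bound, extrapolation, and one-step descent. -/

section Descent

variable {E : Type*} [NormedAddCommGroup E] [InnerProductSpace ℝ E] [FiniteDimensional ℝ E]
  {H : Submodule ℝ (E →L[ℝ] E)} {f : E → ℝ} {L T : E →L[ℝ] E}

/-- The Hessian hypothesis controls the difference only along the displacement, which is what the
derivative of the remainder along the segment needs. The mean value inequality then integrates the
bound `c τ` to `c / 2`. -/
theorem IsSecondOrderSmooth.wnorm_taylor_le (hf : IsSecondOrderSmooth f T) (hT : IsPosDef T)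
    (x d : E) : wnorm (Ring.inverse T) (∇ f (x + d) - ∇ f x - hessian f x d) ≤
      1 / 2 * (√(nuclearNorm T))⁻¹ * wnorm T d ^ 2 := by
  obtain ⟨V, W, hV, hW, -⟩ := hT.exists_sqrt
  set c := (√(nuclearNorm T))⁻¹ * ‖V d‖ ^ 2 with hc
  have hc0 : 0 ≤ c := by positivity
  have hφ : ∀ τ : ℝ, HasDerivAt (fun τ : ℝ => W (∇ f (x + τ • d) - ∇ f x - τ • hessian f x d))
      (W ((hessian f (x + τ • d) - hessian f x) d)) τ := fun τ => by
    have h1 : HasDerivAt (fun τ : ℝ => x + τ • d) d τ := by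
      simpa using ((hasDerivAt_id τ).smul_const d).const_add x
    have h0 : HasFDerivAt (∇ f) (hessian f (x + τ • d)) (x + τ • d) :=
      (hf.differentiable (x + τ • d)).hasFDerivAt
    have h2 : HasDerivAt (fun τ : ℝ => ∇ f (x + τ • d)) (hessian f (x + τ • d) d) τ := by
      have := HasFDerivAt.comp_hasDerivAt (f := fun τ : ℝ => x + τ • d) τ h0 h1
      exact this
    have h3 : HasDerivAt (fun τ : ℝ => τ • hessian f x d) (hessian f x d) τ := by
      simpa using (hasDerivAt_id τ).smul_const (hessian f x d)
    exact W.hasFDerivAt.comp_hasDerivAt τ ((h2.sub_const _).sub h3)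
  have hB : ∀ τ : ℝ, HasDerivAt (fun τ : ℝ => c / 2 * τ ^ 2) (c * τ) τ := fun τ =>
    ((hasDerivAt_pow 2 τ).const_mul (c / 2)).congr_deriv (by norm_num; ring)
  have hbd : ∀ τ ∈ Set.Ico (0 : ℝ) 1,
      ‖W ((hessian f (x + τ • d) - hessian f x) d)‖ ≤ c * τ := fun τ hτ => by
    rcases hτ.1.eq_or_lt with h | h
    · simp [← h]
    -- The displacement is `τ • d`, so the hypothesis reads `τ² ‖·‖² ≤ ‖T‖_tr⁻¹ τ⁴ ‖V d‖⁴`, and `τ²`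
    -- cancels.
    have h1 := hf.hessian_le (x + τ • d) x
    rw [add_sub_cancel_left, map_smul, hW, hV, map_smul, map_smul, norm_smul, norm_smul,
      Real.norm_eq_abs, abs_of_pos h] at h1
    have hτ2 : 0 < τ ^ 2 := by positivity
    refine le_of_sq_le_sq ?_ (by positivity)
    refine le_of_mul_le_mul_left (a := τ ^ 2) ?_ hτ2
    refine (by linarith : τ ^ 2 * _ ≤ (nuclearNorm T)⁻¹ * (τ * ‖V d‖) ^ 4).trans (le_of_eq ?_)
    have hc2 : c ^ 2 = (nuclearNorm T)⁻¹ * ‖V d‖ ^ 4 := by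
      rw [hc, mul_pow, inv_pow, Real.sq_sqrt (nuclearNorm_nonneg T)]
      ring
    rw [mul_pow c, hc2]
    ring
  have := image_norm_le_of_norm_deriv_right_le_deriv_boundary (a := (0 : ℝ)) (b := 1)
    (B := fun τ : ℝ => c / 2 * τ ^ 2) (B' := fun τ => c * τ)
    (fun τ _ => (hφ τ).continuousAt.continuousWithinAt)
    (fun τ _ => (hφ τ).hasDerivWithinAt) (by simp) hB hbd (Set.right_mem_Icc.2 zero_le_one)
  rw [hV, hW]
  simp only [one_smul] at this
  refine this.trans (le_of_eq ?_)
  rw [hc]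
  ring

/-- Expand both gradients at `y`. The displacements `x - y` and `(1/α - 1)(y - x)`, weighted by `1 -
α` and `α`, sum to zero, so the Hessian terms cancel. The Taylor remainders carry total weight
`(1-α)/2 + α(1/α-1)²/2 = (1-α)/(2α)`. -/
theorem IsStructured.dualSup_extrapolation_le (hH : IsStructured H) (hT : T ∈ H)
    (hTp : IsPosDef T) (hf : IsSecondOrderSmooth f T) {α : ℝ} (hα : 0 < α) (hα1 : α ≤ 1)
    (x y : E) :
    dualSup H ((1 - α) • ∇ f x + α • ∇ f (x + (1 / α) • (y - x)) - ∇ f y) ≤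
      nuclearNorm T * primalNorm H (y - x) ^ 2 / (2 * α) := by
  set t := nuclearNorm T
  have ht : 0 ≤ t := nuclearNorm_nonneg T
  obtain ⟨V, W, hV, hW, -⟩ := hTp.exists_sqrt
  have hα' : 0 ≤ 1 / α - 1 := sub_nonneg.2 ((le_div_iff₀ hα).2 (by linarith))
  have e1 := hf.wnorm_taylor_le hTp y (x - y)
  have e2 := hf.wnorm_taylor_le hTp y ((1 / α - 1) • (y - x))
  rw [add_sub_cancel] at e1
  have hpt : y + (1 / α - 1) • (y - x) = x + (1 / α) • (y - x) := by
    rw [sub_smul, one_smul]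
    abel
  rw [hpt] at e2
  rw [hV, hW] at e1 e2
  have hVs : ‖V (x - y)‖ = ‖V (y - x)‖ := by rw [← norm_neg, ← map_neg, neg_sub]
  rw [hVs] at e1
  rw [map_smul V, norm_smul, Real.norm_eq_abs, abs_of_nonneg hα', mul_pow] at e2
  have hr : (1 - α) • ∇ f x + α • ∇ f (x + (1 / α) • (y - x)) - ∇ f y =
      (1 - α) • (∇ f x - ∇ f y - hessian f y (x - y)) +
      α • (∇ f (x + (1 / α) • (y - x)) - ∇ f y - hessian f y ((1 / α - 1) • (y - x))) := by
    have h1 : hessian f y (x - y) = - hessian f y (y - x) := by rw [← map_neg, neg_sub]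
    have h2 : α * (1 / α - 1) = 1 - α := by field_simp
    rw [h1, map_smul, smul_sub α, smul_smul α, h2]
    generalize ∇ f (x + (1 / α) • (y - x)) = p
    module
  set u := ∇ f x - ∇ f y - hessian f y (x - y)
  set v := ∇ f (x + (1 / α) • (y - x)) - ∇ f y - hessian f y ((1 / α - 1) • (y - x))
  rw [hr]
  refine (hH.dualSup_le_wnorm hT hTp _).trans ?_
  rw [hW, map_add, map_smul, map_smul]
  have e3 : ‖(1 - α) • W u + α • W v‖ ≤ (√t)⁻¹ * (‖V (y - x)‖ ^ 2 / (2 * α)) := by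
    refine (norm_add_le _ _).trans ?_
    rw [norm_smul, norm_smul, Real.norm_eq_abs, Real.norm_eq_abs, abs_of_pos hα,
      abs_of_nonneg (sub_nonneg.2 hα1)]
    refine (add_le_add (mul_le_mul_of_nonneg_left e1 (sub_nonneg.2 hα1))
      (mul_le_mul_of_nonneg_left e2 hα.le)).trans ?_
    have : (1 - α) * (1 / 2 * (√t)⁻¹ * ‖V (y - x)‖ ^ 2) +
        α * (1 / 2 * (√t)⁻¹ * ((1 / α - 1) ^ 2 * ‖V (y - x)‖ ^ 2)) =
        (1 - α) * ((√t)⁻¹ * (‖V (y - x)‖ ^ 2 / (2 * α))) := by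
      field_simp
      ring
    rw [this]
    exact mul_le_of_le_one_left (by positivity) (by linarith)
  have e4 := hH.wnorm_le hT hTp (y - x)
  rw [hV] at e4
  have e5 : ‖V (y - x)‖ ^ 2 ≤ t * primalNorm H (y - x) ^ 2 := by
    refine (pow_le_pow_left₀ (norm_nonneg _) e4 2).trans (le_of_eq ?_)
    rw [mul_pow, Real.sq_sqrt ht]
  calc √t * ‖(1 - α) • W u + α • W v‖ ≤ √t * ((√t)⁻¹ * (‖V (y - x)‖ ^ 2 / (2 * α))) := by gcongr
    _ = √t * (√t)⁻¹ * (‖V (y - x)‖ ^ 2 / (2 * α)) := by ring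
    _ ≤ 1 * (‖V (y - x)‖ ^ 2 / (2 * α)) := by
        gcongr
        exact mul_inv_le_one
    _ ≤ _ := by
        rw [one_mul]
        gcongr

/-- Replacing `∇f(x)` by `m` costs `⟨m - ∇f(x), y - x'⟩`, with `y` and `x'` in one ball of radius
`η`. The hypothesis `hx` places `x` in that ball too, so `R(x' - x) ≤ 2η` and the smoothness term is
`½‖L‖_tr (2η)²`. -/
theorem IsStructured.descent (hH : IsStructured H) (hL : L ∈ H) (hLp : IsPosDef L)
    (hf : IsSmooth f L) {β η : ℝ} {x x' m : E}
    (hx : primalNorm H (β • x) ≤ η) (hfeas : primalNorm H (x' - (1 - β) • x) ≤ η)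
    (hmin : ∀ y : E, primalNorm H (y - (1 - β) • x) ≤ η → ⟪m, x' - x⟫ ≤ ⟪m, y - x⟫)
    {y : E} (hy : primalNorm H (y - (1 - β) • x) ≤ η) :
    f x' ≤ f x + ⟪∇ f x, y - x⟫ + 2 * η * dualSup H (m - ∇ f x) +
      2 * nuclearNorm L * η ^ 2 := by
  have h1 := (abs_le.1 (hf.bregman_le x' x)).2
  have h2 := hmin y hy
  have h3 := hH.inner_le (m - ∇ f x) (y - x')
  have hyx : primalNorm H (y - x') ≤ 2 * η := by
    have : y - x' = (y - (1 - β) • x) - (x' - (1 - β) • x) := by abel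
    rw [this]
    linarith [hH.primalNorm_sub_le (y - (1 - β) • x) (x' - (1 - β) • x)]
  have hxx : primalNorm H (x' - x) ≤ 2 * η := by
    have : x' - x = (x' - (1 - β) • x) - β • x := by
      rw [sub_smul, one_smul]
      abel
    rw [this]
    linarith [hH.primalNorm_sub_le (x' - (1 - β) • x) (β • x)]
  have h4 := mul_le_mul_of_nonneg_left hyx (hH.dualSup_nonneg (m - ∇ f x))
  have h5 : wnorm L (x' - x) ^ 2 ≤ nuclearNorm L * (2 * η) ^ 2 := by
    refine (pow_le_pow_left₀ (wnorm_nonneg _ _) (hH.wnorm_le hL hLp (x' - x)) 2).trans ?_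
    rw [mul_pow, Real.sq_sqrt (nuclearNorm_nonneg L)]
    exact mul_le_mul_of_nonneg_left (pow_le_pow_left₀ (primalNorm_nonneg _) hxx 2)
      (nuclearNorm_nonneg L)
  have h6 : ⟪m - ∇ f x, y - x'⟫ = ⟪m, y - x⟫ - ⟪m, x' - x⟫ - ⟪∇ f x, y - x⟫ +
      ⟪∇ f x, x' - x⟫ := by
    simp only [inner_sub_left, inner_sub_right]
    ring
  linarith

/-- The relation between weight decay, stepsize and radius. -/
def Compatible (D : ℝ≥0∞) (β η : ℝ) : Prop :=
  if D = ⊤ then β = 0 else η = β * D.toReal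

theorem IsStructured.primalNorm_decay_le (hH : IsStructured H) {D : ℝ≥0∞} {β η : ℝ}
    (hβ : 0 ≤ β) (hη : 0 ≤ η) (hc : Compatible D β η) {x : E} (hx : x ∈ ball H D) :
    primalNorm H (β • x) ≤ η := by
  rw [hH.primalNorm_smul, abs_of_nonneg hβ]
  by_cases hD : D = ⊤
  · rw [Compatible, if_pos hD] at hc
    simpa [hc] using hη
  · rw [Compatible, if_neg hD] at hc
    rw [hc]
    exact mul_le_mul_of_nonneg_left ((mem_ball_iff hD x).1 hx) hβ

theorem IsStructured.mem_ball_of_feasible (hH : IsStructured H) {D : ℝ≥0∞} {β η : ℝ}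
    (hβ1 : β ≤ 1) (hc : Compatible D β η) {x x' : E} (hx : x ∈ ball H D)
    (hfeas : primalNorm H (x' - (1 - β) • x) ≤ η) : x' ∈ ball H D := by
  by_cases hD : D = ⊤
  · simp [hD, ball]
  · rw [Compatible, if_neg hD] at hc
    rw [mem_ball_iff hD] at hx ⊢
    have h1 := hH.primalNorm_add_le (x' - (1 - β) • x) ((1 - β) • x)
    rw [sub_add_cancel, hH.primalNorm_smul (1 - β), abs_of_nonneg (sub_nonneg.2 hβ1)] at h1
    have := mul_le_mul_of_nonneg_left hx (sub_nonneg.2 hβ1)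
    linarith

theorem IsStructured.feasible_of_mem_ball (hH : IsStructured H) {D : ℝ≥0∞} (hD : D ≠ ⊤)
    {β η : ℝ} (hβ : 0 ≤ β) (hc : Compatible D β η) (x : E) {y : E} (hy : y ∈ ball H D) :
    primalNorm H (((1 - β) • x + β • y) - (1 - β) • x) ≤ η := by
  rw [Compatible, if_neg hD] at hc
  rw [add_sub_cancel_left, hH.primalNorm_smul, abs_of_nonneg hβ, hc]
  exact mul_le_mul_of_nonneg_left ((mem_ball_iff hD y).1 hy) hβ

/-- The comparison points are `x - η v` with `R(v) ≤ 1` if `D = ∞`, and `(1-β) x + β y` with `y ∈ Q`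
otherwise; the supremum over them produces the criterion. -/
theorem IsStructured.criterion_descent (hH : IsStructured H) (hL : L ∈ H) (hLp : IsPosDef L)
    (hf : IsSmooth f L) {D : ℝ≥0∞} (hD0 : 0 < D) {β η : ℝ} (hβ : 0 ≤ β) (hη : 0 ≤ η)
    (hc : Compatible D β η) {x x' m : E} (hx : x ∈ ball H D)
    (hfeas : primalNorm H (x' - (1 - β) • x) ≤ η)
    (hmin : ∀ y : E, primalNorm H (y - (1 - β) • x) ≤ η → ⟪m, x' - x⟫ ≤ ⟪m, y - x⟫) :
    η * criterion H D f x ≤ f x - f x' + 2 * η * dualSup H (m - ∇ f x) +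
      2 * nuclearNorm L * η ^ 2 := by
  have key := fun y hy => hH.descent hL hLp hf (hH.primalNorm_decay_le hβ hη hc hx) hfeas hmin
    (y := y) hy
  set c := f x - f x' + 2 * η * dualSup H (m - ∇ f x) + 2 * nuclearNorm L * η ^ 2 with hcdef
  by_cases hD : D = ⊤
  · have hβ0 : β = 0 := by rwa [Compatible, if_pos hD] at hc
    subst hβ0
    rw [criterion, if_pos hD, hH.dualNorm_eq]
    have h : ∀ v, primalNorm H v ≤ 1 → η * ⟪∇ f x, v⟫ ≤ c := fun v hv => by
      have := key (x - η • v) (by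
        rw [sub_zero, one_smul, sub_sub_cancel_left, hH.primalNorm_neg, hH.primalNorm_smul,
          abs_of_nonneg hη]
        exact mul_le_of_le_one_right hη hv)
      rw [sub_sub_cancel_left, inner_neg_right, inner_smul_right] at this
      linarith
    -- When `η = 0` one cannot divide by it; the choice `v = 0` still shows that the right-hand side
    -- is nonnegative. For `β = 0` below, `y = x` plays the same role.
    rcases hη.eq_or_lt with h0 | h0
    · have := h 0 (by simp [hH.primalNorm_zero])
      rw [← h0] at this ⊢
      linarith
    · rw [← le_div_iff₀' h0]
      exact hH.dualSup_le fun v hv => (le_div_iff₀' h0).2 (h v hv)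
  · have hD' : 0 < D.toReal := ENNReal.toReal_pos hD0.ne' hD
    have hηβ : η = β * D.toReal := by rwa [Compatible, if_neg hD] at hc
    have h : ∀ y ∈ ball H D, β * ⟪∇ f x, x - y⟫ ≤ c := fun y hy => by
      have := key _ (hH.feasible_of_mem_ball hD hβ hc x hy)
      have e : (1 - β) • x + β • y - x = -(β • (x - y)) := by
        rw [sub_smul, one_smul, smul_sub]
        abel
      rw [e, inner_neg_right, inner_smul_right] at this
      linarith
    have e : η * criterion H D f x = β * sSup ((fun y => ⟪∇ f x, x - y⟫) '' ball H D) := by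
      rw [criterion, if_neg hD, hηβ]
      field_simp
    rw [e]
    rcases hβ.eq_or_lt with h0 | h0
    · have := h x hx
      rw [← h0] at this ⊢
      linarith
    · rw [← le_div_iff₀' h0]
      refine csSup_le ⟨_, x, hx, rfl⟩ ?_
      rintro _ ⟨y, hy, rfl⟩
      exact (le_div_iff₀' h0).2 (h y hy)

theorem IsSmooth.inner_gradient_le (hf : IsSmooth f L) (hconv : ConvexOn ℝ Set.univ f) (x y : E) :
    ⟪∇ f x, y - x⟫ ≤ f y - f x := by
  have hd : HasDerivAt (fun τ : ℝ => f (x + τ • (y - x))) ⟪∇ f x, y - x⟫ 0 := by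
    have h1 : HasDerivAt (fun τ : ℝ => x + τ • (y - x)) (y - x) 0 := by
      simpa using ((hasDerivAt_id (0 : ℝ)).smul_const (y - x)).const_add x
    have h2 : HasGradientAt f (∇ f x) (x + (0 : ℝ) • (y - x)) := by
      simpa using (hf.contDiff.differentiable one_ne_zero x).hasGradientAt
    exact h2.hasFDerivAt.comp_hasDerivAt (0 : ℝ) h1
  have hc : ConvexOn ℝ Set.univ (fun τ : ℝ => f (x + τ • (y - x))) := by
    refine ⟨convex_univ, fun a _ b _ p q hp hq hpq => ?_⟩
    have := hconv.2 (Set.mem_univ (x + a • (y - x))) (Set.mem_univ (x + b • (y - x))) hp hq hpq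
    refine le_trans (le_of_eq ?_) this
    obtain rfl : q = 1 - p := by linarith
    refine congrArg f ?_
    simp only [smul_eq_mul]
    module
  have := hc.le_slope_of_hasDerivAt (Set.mem_univ 0) (Set.mem_univ 1) zero_lt_one hd
  simpa [slope] using this

theorem optValue_le {D : ℝ≥0∞} (hb : BddBelow (f '' ball H D)) {y : E} (hy : y ∈ ball H D) :
    optValue H D f ≤ f y := csInf_le hb ⟨y, hy, rfl⟩

/-- Compare with `(1-β) x + β y` and bound the gradient term by convexity. The infimum over `Q` is
taken only at the end, so no minimizer of `f` has to be produced. -/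
theorem IsStructured.convex_descent (hH : IsStructured H) (hL : L ∈ H) (hLp : IsPosDef L)
    (hf : IsSmooth f L) (hconv : ConvexOn ℝ Set.univ f) {D : ℝ≥0∞} (hD : D ≠ ⊤)
    {β η : ℝ} (hβ : 0 ≤ β) (hη : 0 ≤ η)
    (hc : Compatible D β η) {x x' m : E} (hx : x ∈ ball H D)
    (hfeas : primalNorm H (x' - (1 - β) • x) ≤ η)
    (hmin : ∀ y : E, primalNorm H (y - (1 - β) • x) ≤ η → ⟪m, x' - x⟫ ≤ ⟪m, y - x⟫) :
    f x' - optValue H D f ≤ (1 - β) * (f x - optValue H D f) +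
      2 * η * dualSup H (m - ∇ f x) + 2 * nuclearNorm L * η ^ 2 := by
  set c := (f x' - f x) - 2 * η * dualSup H (m - ∇ f x) - 2 * nuclearNorm L * η ^ 2 + β * f x
    with hcdef
  have key : ∀ y ∈ ball H D, c ≤ β * f y := fun y hy => by
    have h1 := hH.descent hL hLp hf (hH.primalNorm_decay_le hβ hη hc hx) hfeas hmin
      (hH.feasible_of_mem_ball hD hβ hc x hy)
    have e : (1 - β) • x + β • y - x = β • (y - x) := by
      rw [sub_smul, one_smul, smul_sub]
      abel
    rw [e, inner_smul_right] at h1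
    have h2 := mul_le_mul_of_nonneg_left (hf.inner_gradient_le hconv x y) hβ
    linarith
  have : c ≤ β * optValue H D f := by
    rcases hβ.eq_or_lt with h0 | h0
    · have := key x hx
      rw [← h0] at this ⊢
      linarith
    · rw [← div_le_iff₀' h0]
      refine le_csInf ⟨_, x, hx, rfl⟩ ?_
      rintro _ ⟨y, hy, rfl⟩
      exact (div_le_iff₀' h0).2 (key y hy)
  linarith

end Descent

/-! ### Second moments of fresh gradient noise. -/

section Noise

variable {E : Type*} [NormedAddCommGroup E] [InnerProductSpace ℝ E] [FiniteDimensional ℝ E]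
  [MeasurableSpace E] [BorelSpace E] {Ξ : Type*} [MeasurableSpace Ξ] {𝒟 : Measure Ξ}
  [IsProbabilityMeasure 𝒟] {f : E → ℝ} {g : E → Ξ → E} {S W : E →L[ℝ] E}

/-- Expand the square at frozen `a`, `z`; unbiasedness removes the cross term. -/
theorem IsGradientEstimator.integral_sq_le (hg : IsGradientEstimator f g 𝒟 S)
    (hW : ∀ x, wnorm (Ring.inverse S) x = ‖W x‖) (p q : ℝ) (a z : E) :
    Integrable (fun ζ => ‖W (p • a + q • (g z ζ - ∇ f z))‖ ^ 2) 𝒟 ∧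
    ∫ ζ, ‖W (p • a + q • (g z ζ - ∇ f z))‖ ^ 2 ∂𝒟 ≤
      p ^ 2 * ‖W a‖ ^ 2 + q ^ 2 * nuclearNorm S := by
  have hn : Integrable (fun ζ => g z ζ - ∇ f z) 𝒟 := (hg.integrable z).sub (integrable_const _)
  have hWn : Integrable (fun ζ => W (g z ζ - ∇ f z)) 𝒟 := W.integrable_comp hn
  have hin : Integrable (fun ζ => ⟪W a, W (g z ζ - ∇ f z)⟫) 𝒟 := hWn.const_inner (W a)
  have hzero : ∫ ζ, ⟪W a, W (g z ζ - ∇ f z)⟫ ∂𝒟 = 0 := by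
    rw [integral_inner hWn, ContinuousLinearMap.integral_comp_comm W hn,
      integral_sub (hg.integrable z) (integrable_const _), hg.unbiased]
    simp
  have hsq : Integrable (fun ζ => ‖W (g z ζ - ∇ f z)‖ ^ 2) 𝒟 := by
    simpa only [hW] using hg.integrable_noise z
  have hvar : ∫ ζ, ‖W (g z ζ - ∇ f z)‖ ^ 2 ∂𝒟 ≤ nuclearNorm S := by
    simpa only [hW] using hg.variance_le z
  have hexp : ∀ ζ, ‖W (p • a + q • (g z ζ - ∇ f z))‖ ^ 2 = p ^ 2 * ‖W a‖ ^ 2 +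
      2 * p * q * ⟪W a, W (g z ζ - ∇ f z)⟫ + q ^ 2 * ‖W (g z ζ - ∇ f z)‖ ^ 2 := fun ζ => by
    rw [map_add, map_smul, map_smul, norm_add_sq_real, norm_smul, norm_smul, mul_pow, mul_pow,
      inner_smul_left, inner_smul_right, Real.norm_eq_abs, Real.norm_eq_abs, sq_abs, sq_abs]
    simp only [conj_trivial]
    ring
  simp_rw [hexp]
  have h1 : Integrable (fun ζ => p ^ 2 * ‖W a‖ ^ 2 +
      2 * p * q * ⟪W a, W (g z ζ - ∇ f z)⟫) 𝒟 :=
    (integrable_const _).add (hin.const_mul _)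
  refine ⟨h1.add (hsq.const_mul _), ?_⟩
  rw [integral_add h1 (hsq.const_mul _), integral_add (integrable_const _) (hin.const_mul _),
    integral_const, integral_const_mul, integral_const_mul, hzero, probReal_univ, one_smul,
    mul_zero, add_zero]
  exact add_le_add_right (mul_le_mul_of_nonneg_left hvar (sq_nonneg q)) _

variable {Ω : Type*} {m₀ mΩ : MeasurableSpace Ω} {μ : Measure Ω} [IsProbabilityMeasure μ]

/-- Independence makes the joint law of `(a, z)` and `ζ` a product, so Fubini reduces the claim to
the frozen case. -/
theorem IsGradientEstimator.integral_sq_fresh_le (hg : IsGradientEstimator f g 𝒟 S)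
    (hW : ∀ x, wnorm (Ring.inverse S) x = ‖W x‖) (hf : Continuous (∇ f))
    (hm : m₀ ≤ mΩ) {ζ : Ω → Ξ} (hζ : Measurable ζ)
    (hlaw : μ.map ζ = 𝒟) (hind : Indep (MeasurableSpace.comap ζ inferInstance) m₀ μ)
    {a z : Ω → E} (ha : Measurable[m₀] a) (hz : Measurable[m₀] z)
    (hint : Integrable (fun ω => ‖W (a ω)‖ ^ 2) μ) (p q : ℝ) :
    Integrable (fun ω => ‖W (p • a ω + q • (g (z ω) (ζ ω) - ∇ f (z ω)))‖ ^ 2) μ ∧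
    ∫ ω, ‖W (p • a ω + q • (g (z ω) (ζ ω) - ∇ f (z ω)))‖ ^ 2 ∂μ ≤
      p ^ 2 * ∫ ω, ‖W (a ω)‖ ^ 2 ∂μ + q ^ 2 * nuclearNorm S := by
  set Y : Ω → E × E := fun ω => (a ω, z ω) with hYdef
  have hY₀ : Measurable[m₀] Y := ha.prodMk hz
  have hY : Measurable Y := hY₀.mono hm le_rfl
  have hindep : IndepFun Y ζ μ := by
    rw [IndepFun_iff_Indep]
    exact (indep_of_indep_of_le_right hind (measurable_iff_comap_le.1 hY₀)).symm
  have hmap : μ.map (fun ω => (Y ω, ζ ω)) = (μ.map Y).prod 𝒟 := by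
    rw [(indepFun_iff_map_prod_eq_prod_map_map hY.aemeasurable hζ.aemeasurable).1 hindep, hlaw]
  have : IsProbabilityMeasure (μ.map Y) := Measure.isProbabilityMeasure_map hY.aemeasurable
  set ψ : (E × E) × Ξ → ℝ :=
    fun w => ‖W (p • w.1.1 + q • (g w.1.2 w.2 - ∇ f w.1.2))‖ ^ 2 with hψdef
  have hψ : Measurable ψ := by
    have h1 : Measurable fun w : (E × E) × Ξ => g w.1.2 w.2 :=
      hg.measurable.comp ((measurable_snd.comp measurable_fst).prodMk measurable_snd)
    have h2 : Measurable fun w : (E × E) × Ξ => ∇ f w.1.2 :=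
      hf.measurable.comp (measurable_snd.comp measurable_fst)
    have h3 : Measurable fun w : (E × E) × Ξ => w.1.1 := measurable_fst.comp measurable_fst
    exact ((W.continuous.measurable.comp
      ((h3.const_smul p).add ((h1.sub h2).const_smul q))).norm).pow_const 2
  have hslice := fun w : E × E => hg.integral_sq_le hW p q w.1 w.2
  have hbound : Integrable (fun w : E × E => p ^ 2 * ‖W w.1‖ ^ 2 + q ^ 2 * nuclearNorm S)
      (μ.map Y) := by
    refine Integrable.add (Integrable.const_mul ?_ _) (integrable_const _)
    refine (integrable_map_measure ?_ hY.aemeasurable).2 hint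
    exact ((W.continuous.comp continuous_fst).norm.pow 2).aestronglyMeasurable
  have hmeas : AEStronglyMeasurable (fun w : E × E => ∫ ξ, ψ (w, ξ) ∂𝒟) (μ.map Y) :=
    hψ.stronglyMeasurable.integral_prod_right'.aestronglyMeasurable
  have hI : Integrable (fun w : E × E => ∫ ξ, ψ (w, ξ) ∂𝒟) (μ.map Y) := by
    refine hbound.mono' hmeas (Filter.Eventually.of_forall fun w => ?_)
    rw [Real.norm_eq_abs, abs_of_nonneg (integral_nonneg fun _ => sq_nonneg _)]
    exact (hslice w).2
  have hψint : Integrable ψ ((μ.map Y).prod 𝒟) := by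
    refine (integrable_prod_iff hψ.aestronglyMeasurable).2
      ⟨Filter.Eventually.of_forall fun w => (hslice w).1, ?_⟩
    refine hI.congr (Filter.Eventually.of_forall fun w => ?_)
    refine integral_congr_ae (Filter.Eventually.of_forall fun ξ => ?_)
    exact (Real.norm_of_nonneg (sq_nonneg _)).symm
  rw [← hmap] at hψint
  have hYζ : AEMeasurable (fun ω => (Y ω, ζ ω)) μ := (hY.prodMk hζ).aemeasurable
  refine ⟨(integrable_map_measure hψ.aestronglyMeasurable hYζ).1 hψint, ?_⟩
  calc ∫ ω, ‖W (p • a ω + q • (g (z ω) (ζ ω) - ∇ f (z ω)))‖ ^ 2 ∂μ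
      = ∫ w, ψ w ∂(μ.map fun ω => (Y ω, ζ ω)) :=
        (integral_map hYζ hψ.aestronglyMeasurable).symm
    _ = ∫ w, ∫ ξ, ψ (w, ξ) ∂𝒟 ∂(μ.map Y) := by
        rw [hmap] at hψint ⊢
        exact integral_prod ψ hψint
    _ ≤ ∫ w, (p ^ 2 * ‖W w.1‖ ^ 2 + q ^ 2 * nuclearNorm S) ∂(μ.map Y) :=
        integral_mono hI hbound fun w => (hslice w).2
    _ = ∫ ω, (p ^ 2 * ‖W (a ω)‖ ^ 2 + q ^ 2 * nuclearNorm S) ∂μ :=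
        integral_map hY.aemeasurable hbound.aestronglyMeasurable
    _ = _ := by
        rw [integral_add (hint.const_mul _) (integrable_const _), integral_const_mul]
        simp

/-- The pointwise bound `|X| ≤ X²/(2c) + c/2` gives integrability and the Jensen-type estimate at
once. -/
theorem integral_le_of_integral_sq_le {X : Ω → ℝ} (hX : AEStronglyMeasurable X μ)
    (hsq : Integrable (fun ω => X ω ^ 2) μ) {c : ℝ} (hc : 0 < c)
    (h : ∫ ω, X ω ^ 2 ∂μ ≤ c ^ 2) : Integrable X μ ∧ ∫ ω, X ω ∂μ ≤ c := by
  have hb : Integrable (fun ω => X ω ^ 2 / (2 * c) + c / 2) μ :=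
    (hsq.div_const _).add (integrable_const _)
  have hle : ∀ ω, |X ω| ≤ X ω ^ 2 / (2 * c) + c / 2 := fun ω => by
    rw [div_add_div _ _ (by positivity) two_ne_zero, le_div_iff₀ (by positivity), ← sq_abs]
    nlinarith [sq_nonneg (|X ω| - c)]
  have hint : Integrable X μ := hb.mono' hX (Filter.Eventually.of_forall hle)
  refine ⟨hint, ?_⟩
  calc ∫ ω, X ω ∂μ ≤ ∫ ω, (X ω ^ 2 / (2 * c) + c / 2) ∂μ :=
        integral_mono hint hb fun ω => (le_abs_self _).trans (hle ω)
    _ = (∫ ω, X ω ^ 2 ∂μ) / (2 * c) + c / 2 := by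
        rw [integral_add (hsq.div_const _) (integrable_const _), integral_div]
        simp
    _ ≤ c ^ 2 / (2 * c) + c / 2 := by gcongr
    _ = c := by
        field_simp
        ring

end Noise

/-! ### Noise and bias of the momentum along a run. -/

section Run

variable {E : Type*} [NormedAddCommGroup E] [InnerProductSpace ℝ E] [FiniteDimensional ℝ E]
  [MeasurableSpace E] [BorelSpace E] {H : Submodule ℝ (E →L[ℝ] E)} {L S T : E →L[ℝ] E}
  {Ξ : Type*} [MeasurableSpace Ξ] {𝒟 : Measure Ξ} [IsProbabilityMeasure 𝒟]
  {f : E → ℝ} {g : E → Ξ → E} {Ω : Type*} {mΩ : MeasurableSpace Ω} {μ : Measure Ω}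
  [IsProbabilityMeasure μ] {α β η : ℝ} {x₀ : E} {ℱ : Filtration ℕ mΩ} {ξ : ℕ → Ω → Ξ}
  {x m : ℕ → Ω → E} {D : ℝ≥0∞}

/-- The extrapolated point at which the stochastic gradient is evaluated. -/
noncomputable def extrapolation (α : ℝ) (x : ℕ → Ω → E) (k : ℕ) (ω : Ω) : E :=
  x k ω + (1 / α) • (x (k + 1) ω - x k ω)

/-- The exponential average of the gradient noise along a run. -/
noncomputable def averagedNoise (f : E → ℝ) (g : E → Ξ → E) (α : ℝ) (ξ : ℕ → Ω → Ξ)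
    (x : ℕ → Ω → E) : ℕ → Ω → E
  | 0, ω => g (x 0 ω) (ξ 0 ω) - ∇ f (x 0 ω)
  | k + 1, ω => (1 - α) • averagedNoise f g α ξ x k ω +
      α • (g (extrapolation α x k ω) (ξ (k + 1) ω) - ∇ f (extrapolation α x k ω))

theorem IsRun.measurable_iterate (hr : IsRun H g 𝒟 α β η x₀ μ ℱ ξ x m) (k : ℕ) :
    Measurable[ℱ k] (x k) := by
  cases k with
  | zero =>
    rw [show x 0 = fun _ => x₀ from funext hr.x_zero]
    exact measurable_const
  | succ k => exact (hr.x_measurable k).mono (ℱ.mono (Nat.le_succ k)) le_rfl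

theorem IsRun.measurable_extrapolation (hr : IsRun H g 𝒟 α β η x₀ μ ℱ ξ x m) (k : ℕ) :
    Measurable[ℱ k] (extrapolation α x k) :=
  (hr.measurable_iterate k).add
    (((hr.x_measurable k).sub (hr.measurable_iterate k)).const_smul (1 / α))

theorem IsRun.measurable_averagedNoise (hr : IsRun H g 𝒟 α β η x₀ μ ℱ ξ x m)
    (hg : IsGradientEstimator f g 𝒟 S) (hf : Continuous (∇ f)) (k : ℕ) :
    Measurable[ℱ k] (averagedNoise f g α ξ x k) := by
  induction k with
  | zero =>
    exact (hg.measurable.comp ((hr.measurable_iterate 0).prodMk (hr.sample_measurable 0))).sub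
      (hf.measurable.comp (hr.measurable_iterate 0))
  | succ k ih =>
    have hle := ℱ.mono (Nat.le_succ k)
    have hz := (hr.measurable_extrapolation k).mono hle le_rfl
    exact ((ih.mono hle le_rfl).const_smul (1 - α)).add
      (((hg.measurable.comp (hz.prodMk (hr.sample_measurable (k + 1)))).sub
        (hf.measurable.comp hz)).const_smul α)

/-- The second moments satisfy `e_{k+1} ≤ (1-α)² e_k + α² ‖Σ‖_tr`. The summand `α` survives the
recursion because `(1-α)² α + α² ≤ α` for `α ∈ [0,1]`. -/
theorem IsRun.integral_sq_averagedNoise_le (hr : IsRun H g 𝒟 α β η x₀ μ ℱ ξ x m)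
    (hg : IsGradientEstimator f g 𝒟 S) (hf : Continuous (∇ f)) {W : E →L[ℝ] E}
    (hW : ∀ x, wnorm (Ring.inverse S) x = ‖W x‖) (hα : 0 ≤ α) (hα1 : α ≤ 1) (k : ℕ) :
    Integrable (fun ω => ‖W (averagedNoise f g α ξ x k ω)‖ ^ 2) μ ∧
    ∫ ω, ‖W (averagedNoise f g α ξ x k ω)‖ ^ 2 ∂μ ≤
      nuclearNorm S * (((1 - α) ^ k) ^ 2 + α) := by
  have hξ := fun k => (hr.sample_measurable k).mono (ℱ.le k) le_rfl
  induction k with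
  | zero =>
    -- The first sample has no past: take the trivial σ-algebra and `a = 0`.
    have h := hg.integral_sq_fresh_le hW hf (m₀ := ⊥) bot_le (hξ 0) (hr.sample_law 0)
      (indep_bot_right _) (a := fun _ => 0) (z := fun _ => x₀) measurable_const measurable_const
      (by simp) 1 1
    have e : ∀ ω, averagedNoise f g α ξ x 0 ω =
        (1 : ℝ) • (0 : E) + (1 : ℝ) • (g x₀ (ξ 0 ω) - ∇ f x₀) := fun ω => by
      simp [averagedNoise, hr.x_zero]
    simp_rw [e]
    refine ⟨h.1, h.2.trans ?_⟩
    have := mul_nonneg (nuclearNorm_nonneg S) hα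
    simp
    linarith
  | succ k ih =>
    have h := hg.integral_sq_fresh_le hW hf (ℱ.le k) (hξ (k + 1)) (hr.sample_law (k + 1))
      (hr.sample_indep k) (hr.measurable_averagedNoise hg hf k) (hr.measurable_extrapolation k)
      ih.1 (1 - α) α
    refine ⟨h.1, h.2.trans ?_⟩
    have h1 := mul_le_mul_of_nonneg_left ih.2 (sq_nonneg (1 - α))
    have h2 : 0 ≤ nuclearNorm S * (α * (1 - ((1 - α) ^ 2 + α))) :=
      mul_nonneg (nuclearNorm_nonneg S) (mul_nonneg hα (by nlinarith))
    refine (add_le_add_left h1 _).trans ?_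
    rw [pow_succ (1 - α) k]
    generalize (1 - α) ^ k = u
    linarith

/-- One factor `√‖Σ‖_tr` comes from the second moment, the other from passing to the dual norm; `u²
+ α ≤ (u + √α)²` removes the square. -/
theorem IsRun.integral_dualSup_averagedNoise_le (hr : IsRun H g 𝒟 α β η x₀ μ ℱ ξ x m)
    (hH : IsStructured H) (hS : S ∈ H) (hSp : IsPosDef S) (hs : 0 < nuclearNorm S)
    (hg : IsGradientEstimator f g 𝒟 S) (hf : Continuous (∇ f))
    (hα : 0 < α) (hα1 : α ≤ 1) (k : ℕ) :
    Integrable (fun ω => dualSup H (averagedNoise f g α ξ x k ω)) μ ∧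
    ∫ ω, dualSup H (averagedNoise f g α ξ x k ω) ∂μ ≤
      nuclearNorm S * ((1 - α) ^ k + √α) := by
  obtain ⟨V, W, hV, hW, -⟩ := hSp.exists_sqrt
  set s := nuclearNorm S
  have hm : Measurable (averagedNoise f g α ξ x k) :=
    (hr.measurable_averagedNoise hg hf k).mono (ℱ.le k) le_rfl
  have hpow : 0 ≤ (1 - α) ^ k := pow_nonneg (sub_nonneg.2 hα1) k
  have hsα : 0 < √α := Real.sqrt_pos.2 hα
  obtain ⟨h1, h2⟩ := hr.integral_sq_averagedNoise_le hg hf hW hα.le hα1 k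
  have hc : 0 < √s * ((1 - α) ^ k + √α) := mul_pos (Real.sqrt_pos.2 hs) (by linarith)
  obtain ⟨h3, h4⟩ := integral_le_of_integral_sq_le
    (X := fun ω => ‖W (averagedNoise f g α ξ x k ω)‖)
    (W.continuous.measurable.comp hm).norm.aestronglyMeasurable h1 hc (h2.trans (by
      rw [mul_pow, Real.sq_sqrt hs.le]
      refine mul_le_mul_of_nonneg_left ?_ hs.le
      have := Real.sq_sqrt hα.le
      nlinarith [mul_nonneg hpow hsα.le]))
  have hle : ∀ ω, dualSup H (averagedNoise f g α ξ x k ω) ≤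
      √s * ‖W (averagedNoise f g α ξ x k ω)‖ := fun ω => by
    rw [← hW]
    exact hH.dualSup_le_wnorm hS hSp _
  have hint : Integrable (fun ω => dualSup H (averagedNoise f g α ξ x k ω)) μ := by
    refine (h3.const_mul (√s)).mono'
      (hH.continuous_dualSup.measurable.comp hm).aestronglyMeasurable
      (Filter.Eventually.of_forall fun ω => ?_)
    rw [Real.norm_of_nonneg (hH.dualSup_nonneg _)]
    exact hle ω
  refine ⟨hint, (integral_mono hint (h3.const_mul _) hle).trans ?_⟩
  rw [integral_const_mul]
  refine (mul_le_mul_of_nonneg_left h4 (Real.sqrt_nonneg s)).trans (le_of_eq ?_)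
  rw [← mul_assoc, Real.mul_self_sqrt hs.le]

theorem IsRun.mem_ball (hr : IsRun H g 𝒟 α β η x₀ μ ℱ ξ x m) (hH : IsStructured H)
    (hx₀ : x₀ ∈ ball H D) (hβ1 : β ≤ 1) (hc : Compatible D β η) (k : ℕ) (ω : Ω) :
    x k ω ∈ ball H D := by
  induction k with
  | zero => rwa [hr.x_zero]
  | succ k ih => exact hH.mem_ball_of_feasible hβ1 hc ih (hr.x_feasible k ω)

theorem IsRun.primalNorm_increment_le (hr : IsRun H g 𝒟 α β η x₀ μ ℱ ξ x m)
    (hH : IsStructured H) (hx₀ : x₀ ∈ ball H D) (hβ : 0 ≤ β) (hβ1 : β ≤ 1) (hη : 0 ≤ η)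
    (hc : Compatible D β η) (k : ℕ) (ω : Ω) :
    primalNorm H (x (k + 1) ω - x k ω) ≤ 2 * η := by
  have h1 := hH.primalNorm_decay_le hβ hη hc (hr.mem_ball hH hx₀ hβ1 hc k ω)
  have h2 := hr.x_feasible k ω
  have : x (k + 1) ω - x k ω = (x (k + 1) ω - (1 - β) • x k ω) - β • x k ω := by
    rw [sub_smul, one_smul]
    abel
  rw [this]
  linarith [hH.primalNorm_sub_le (x (k + 1) ω - (1 - β) • x k ω) (β • x k ω)]

/-- A deterministic bound at each fixed `k`, needed only for integrability: when `D = ∞` the set `Q`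
gives none. -/
theorem IsRun.primalNorm_iterate_le (hr : IsRun H g 𝒟 α β η x₀ μ ℱ ξ x m)
    (hH : IsStructured H) (hx₀ : x₀ ∈ ball H D) (hβ : 0 ≤ β) (hβ1 : β ≤ 1) (hη : 0 ≤ η)
    (hc : Compatible D β η) (k : ℕ) (ω : Ω) :
    primalNorm H (x k ω) ≤ primalNorm H x₀ + k * (2 * η) := by
  induction k with
  | zero => simp [hr.x_zero]
  | succ k ih =>
    have h1 := hr.primalNorm_increment_le hH hx₀ hβ hβ1 hη hc k ω
    have h2 := hH.primalNorm_add_le (x k ω) (x (k + 1) ω - x k ω)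
    rw [add_sub_cancel] at h2
    push_cast
    linarith

theorem IsRun.integrable_comp (hr : IsRun H g 𝒟 α β η x₀ μ ℱ ξ x m)
    (hH : IsStructured H) (hx₀ : x₀ ∈ ball H D) (hβ : 0 ≤ β) (hβ1 : β ≤ 1) (hη : 0 ≤ η)
    (hc : Compatible D β η) (k : ℕ) {h : E → ℝ} (hh : Continuous h) :
    Integrable (fun ω => h (x k ω)) μ := by
  set r := √(nuclearNorm (ContinuousLinearMap.id ℝ E)) * (primalNorm H x₀ + k * (2 * η))
  obtain ⟨c, hcb⟩ := (isCompact_closedBall (0 : E) r).exists_bound_of_continuousOn hh.continuousOn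
  refine (integrable_const c).mono' (hh.measurable.comp
    ((hr.measurable_iterate k).mono (ℱ.le k) le_rfl)).aestronglyMeasurable
    (Filter.Eventually.of_forall fun ω => hcb _ ?_)
  rw [mem_closedBall_zero_iff]
  exact (hH.norm_le _).trans (mul_le_mul_of_nonneg_left
    (hr.primalNorm_iterate_le hH hx₀ hβ hβ1 hη hc k ω) (Real.sqrt_nonneg _))

/-- The bias starts at zero and obeys, for every `ω`, `b_{k+1} ≤ (1-α) b_k + ‖T‖_tr (2η)²/(2α)`; the
bound is the fixed point of this recursion. -/
theorem IsRun.dualSup_sub_averagedNoise_le (hr : IsRun H g 𝒟 α β η x₀ μ ℱ ξ x m)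
    (hH : IsStructured H) (hT : T ∈ H) (hTp : IsPosDef T) (hf : IsSecondOrderSmooth f T)
    (hx₀ : x₀ ∈ ball H D) (hα : 0 < α) (hα1 : α ≤ 1) (hβ : 0 ≤ β) (hβ1 : β ≤ 1) (hη : 0 ≤ η)
    (hc : Compatible D β η) (k : ℕ) (ω : Ω) :
    dualSup H (m k ω - ∇ f (x k ω) - averagedNoise f g α ξ x k ω) ≤
      2 * nuclearNorm T * η ^ 2 / α ^ 2 := by
  have ht := nuclearNorm_nonneg T
  induction k with
  | zero =>
    have : m 0 ω - ∇ f (x 0 ω) - averagedNoise f g α ξ x 0 ω = 0 := by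
      simp [averagedNoise, hr.m_zero, hr.x_zero]
    rw [this, hH.dualSup_zero]
    positivity
  | succ k ih =>
    have e : m (k + 1) ω - ∇ f (x (k + 1) ω) - averagedNoise f g α ξ x (k + 1) ω =
        (1 - α) • (m k ω - ∇ f (x k ω) - averagedNoise f g α ξ x k ω) +
        ((1 - α) • ∇ f (x k ω) + α • ∇ f (x k ω + (1 / α) • (x (k + 1) ω - x k ω)) -
          ∇ f (x (k + 1) ω)) := by
      rw [hr.m_succ, averagedNoise, extrapolation]
      generalize x k ω + (1 / α) • (x (k + 1) ω - x k ω) = z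
      module
    have h1 := hH.dualSup_extrapolation_le hT hTp hf hα hα1 (x k ω) (x (k + 1) ω)
    have h2 := hH.dualSup_smul_le (1 - α) (m k ω - ∇ f (x k ω) - averagedNoise f g α ξ x k ω)
    rw [abs_of_nonneg (sub_nonneg.2 hα1)] at h2
    have h3 := mul_le_mul_of_nonneg_left ih (sub_nonneg.2 hα1)
    have h4 := pow_le_pow_left₀ (primalNorm_nonneg _)
      (hr.primalNorm_increment_le hH hx₀ hβ hβ1 hη hc k ω) 2
    have h5 : nuclearNorm T * primalNorm H (x (k + 1) ω - x k ω) ^ 2 / (2 * α) ≤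
        nuclearNorm T * (2 * η) ^ 2 / (2 * α) := by gcongr
    have h6 : (1 - α) * (2 * nuclearNorm T * η ^ 2 / α ^ 2) +
        nuclearNorm T * (2 * η) ^ 2 / (2 * α) = 2 * nuclearNorm T * η ^ 2 / α ^ 2 := by
      field_simp
      ring
    rw [e]
    refine (hH.dualSup_add_le _ _).trans ?_
    linarith

theorem IsRun.measurable_momentum (hr : IsRun H g 𝒟 α β η x₀ μ ℱ ξ x m)
    (hg : IsGradientEstimator f g 𝒟 S) (k : ℕ) : Measurable[ℱ k] (m k) := by
  induction k with
  | zero =>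
    rw [show m 0 = fun ω => g (x 0 ω) (ξ 0 ω) from funext fun ω => by
      rw [hr.m_zero, hr.x_zero]]
    exact hg.measurable.comp ((hr.measurable_iterate 0).prodMk (hr.sample_measurable 0))
  | succ k ih =>
    have hle := ℱ.mono (Nat.le_succ k)
    have hz := (hr.measurable_extrapolation k).mono hle le_rfl
    rw [show m (k + 1) = fun ω => (1 - α) • m k ω + α • g (extrapolation α x k ω) (ξ (k + 1) ω)
      from funext fun ω => hr.m_succ k ω]
    exact ((ih.mono hle le_rfl).const_smul (1 - α)).add
      ((hg.measurable.comp (hz.prodMk (hr.sample_measurable (k + 1)))).const_smul α)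

theorem IsRun.integral_dualSup_error_le (hr : IsRun H g 𝒟 α β η x₀ μ ℱ ξ x m)
    (hH : IsStructured H) (hS : S ∈ H) (hSp : IsPosDef S) (hs : 0 < nuclearNorm S)
    (hT : T ∈ H) (hTp : IsPosDef T)
    (hg : IsGradientEstimator f g 𝒟 S) (hf : IsSecondOrderSmooth f T)
    (hx₀ : x₀ ∈ ball H D) (hα : 0 < α) (hα1 : α ≤ 1) (hβ : 0 ≤ β) (hβ1 : β ≤ 1) (hη : 0 ≤ η)
    (hc : Compatible D β η) (k : ℕ) :
    Integrable (fun ω => dualSup H (m k ω - ∇ f (x k ω))) μ ∧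
    ∫ ω, dualSup H (m k ω - ∇ f (x k ω)) ∂μ ≤
      nuclearNorm S * ((1 - α) ^ k + √α) + 2 * nuclearNorm T * η ^ 2 / α ^ 2 := by
  have hcont : Continuous (∇ f) := hf.differentiable.continuous
  obtain ⟨h1, h2⟩ := hr.integral_dualSup_averagedNoise_le hH hS hSp hs hg hcont hα hα1 k
  have hle : ∀ ω, dualSup H (m k ω - ∇ f (x k ω)) ≤
      dualSup H (averagedNoise f g α ξ x k ω) + 2 * nuclearNorm T * η ^ 2 / α ^ 2 := fun ω => by
    have h3 := hr.dualSup_sub_averagedNoise_le hH hT hTp hf hx₀ hα hα1 hβ hβ1 hη hc k ω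
    have h4 := hH.dualSup_add_le (averagedNoise f g α ξ x k ω)
      (m k ω - ∇ f (x k ω) - averagedNoise f g α ξ x k ω)
    rw [add_sub_cancel] at h4
    linarith
  have hb := h1.add (integrable_const (μ := μ) (2 * nuclearNorm T * η ^ 2 / α ^ 2))
  have hmeas : Measurable fun ω => dualSup H (m k ω - ∇ f (x k ω)) :=
    hH.continuous_dualSup.measurable.comp
      (((hr.measurable_momentum hg k).mono (ℱ.le k) le_rfl).sub
        (hcont.measurable.comp ((hr.measurable_iterate k).mono (ℱ.le k) le_rfl)))
  have hint : Integrable (fun ω => dualSup H (m k ω - ∇ f (x k ω))) μ := by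
    refine hb.mono' hmeas.aestronglyMeasurable (Filter.Eventually.of_forall fun ω => ?_)
    rw [Real.norm_of_nonneg (hH.dualSup_nonneg _)]
    exact hle ω
  refine ⟨hint, (integral_mono hint hb hle).trans ?_⟩
  simp only [Pi.add_apply]
  rw [integral_add h1 (integrable_const _), integral_const, probReal_univ, one_smul]
  linarith

end Run

/-! ### Rates for general parameters. -/

section Convergence

variable {E : Type*} [NormedAddCommGroup E] [InnerProductSpace ℝ E] [FiniteDimensional ℝ E]
  [MeasurableSpace E] [BorelSpace E] {H : Submodule ℝ (E →L[ℝ] E)} {L S T : E →L[ℝ] E}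
  {Ξ : Type*} [MeasurableSpace Ξ] {𝒟 : Measure Ξ} [IsProbabilityMeasure 𝒟]
  {f : E → ℝ} {g : E → Ξ → E} {Ω : Type*} {mΩ : MeasurableSpace Ω} {μ : Measure Ω}
  [IsProbabilityMeasure μ] {α β η : ℝ} {x₀ : E} {ℱ : Filtration ℕ mΩ} {ξ : ℕ → Ω → Ξ}
  {x m : ℕ → Ω → E} {D : ℝ≥0∞}

theorem integrable_ciInf {K : ℕ} (hK : 0 < K) {G : ℕ → Ω → ℝ} (hm : ∀ k, Measurable (G k))
    (hG : ∀ k, Integrable (G k) μ) :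
    Integrable (fun ω => ⨅ k : Fin K, G k ω) μ ∧
    K * ∫ ω, (⨅ k : Fin K, G k ω) ∂μ ≤ ∑ k ∈ Finset.range K, ∫ ω, G k ω ∂μ := by
  have : Nonempty (Fin K) := ⟨⟨0, hK⟩⟩
  have hint : Integrable (fun ω => ⨅ k : Fin K, G k ω) μ := by
    refine (integrable_finsetSum (Finset.range K) fun k _ => (hG k).abs).mono'
      (Measurable.iInf fun k : Fin K => hm k).aestronglyMeasurable
      (Filter.Eventually.of_forall fun ω => ?_)
    obtain ⟨i, hi⟩ := exists_eq_ciInf_of_finite (f := fun k : Fin K => G k ω)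
    rw [← hi, Real.norm_eq_abs]
    exact Finset.single_le_sum (f := fun k => |G k ω|) (fun k _ => abs_nonneg _)
      (Finset.mem_range.2 i.2)
  refine ⟨hint, ?_⟩
  rw [← nsmul_eq_mul]
  nth_rewrite 1 [← Finset.card_range K]
  refine Finset.card_nsmul_le_sum _ _ _ fun k hk => ?_
  exact integral_mono hint (hG k) fun ω =>
    ciInf_le (Set.finite_range fun k : Fin K => G k ω).bddBelow ⟨k, Finset.mem_range.1 hk⟩

theorem sum_pow_one_sub_le {α : ℝ} (hα : 0 < α) (hα1 : α ≤ 1) (K : ℕ) :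
    ∑ k ∈ Finset.range K, (1 - α) ^ k ≤ 1 / α := by
  have h := mul_neg_geom_sum (1 - α) K
  rw [sub_sub_cancel] at h
  rw [le_div_iff₀' hα, h]
  linarith [pow_nonneg (sub_nonneg.2 hα1) K]

/-- Sum the descent inequality over `k`: function values telescope and end above `f*` because
iterates stay in `Q`, the initial noise sums to at most `1/α`, and the minimum is at most the
average. -/
theorem IsRun.integral_iInf_criterion_le (hr : IsRun H g 𝒟 α β η x₀ μ ℱ ξ x m)
    (hH : IsStructured H) (hL : L ∈ H) (hLp : IsPosDef L)
    (hS : S ∈ H) (hSp : IsPosDef S) (hs : 0 < nuclearNorm S) (hT : T ∈ H) (hTp : IsPosDef T)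
    (hfL : IsSmooth f L) (hg : IsGradientEstimator f g 𝒟 S) (hf : IsSecondOrderSmooth f T)
    (hD : 0 < D) (hb : BddBelow (f '' ball H D)) (hx₀ : x₀ ∈ ball H D)
    (hα : 0 < α) (hα1 : α ≤ 1) (hβ : 0 ≤ β) (hβ1 : β ≤ 1) (hη : 0 ≤ η)
    (hc : Compatible D β η) {K : ℕ} (hK : 0 < K) :
    Integrable (fun ω => ⨅ k : Fin K, criterion H D f (x k ω)) μ ∧
    η * K * ∫ ω, (⨅ k : Fin K, criterion H D f (x k ω)) ∂μ ≤
      f x₀ - optValue H D f + 2 * η * nuclearNorm S / α + K * (2 * η * nuclearNorm S * √α +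
        4 * nuclearNorm T * η ^ 3 / α ^ 2 + 2 * nuclearNorm L * η ^ 2) := by
  have hfc : Continuous f := hfL.contDiff.continuous
  have hcr : Continuous (criterion H D f) :=
    hH.continuous_criterion hD hf.differentiable.continuous
  have hfint := fun k => hr.integrable_comp hH hx₀ hβ hβ1 hη hc k hfc
  have hcint := fun k => hr.integrable_comp hH hx₀ hβ hβ1 hη hc k hcr
  obtain ⟨h1, h2⟩ := integrable_ciInf hK (G := fun k ω => criterion H D f (x k ω))
    (fun k => hcr.measurable.comp ((hr.measurable_iterate k).mono (ℱ.le k) le_rfl)) hcint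
  refine ⟨h1, ?_⟩
  set A := 2 * η * nuclearNorm S * √α +
        4 * nuclearNorm T * η ^ 3 / α ^ 2 + 2 * nuclearNorm L * η ^ 2 with hA
  have hstep : ∀ k, η * ∫ ω, criterion H D f (x k ω) ∂μ ≤
      ∫ ω, f (x k ω) ∂μ - ∫ ω, f (x (k + 1) ω) ∂μ +
        (2 * η * nuclearNorm S * (1 - α) ^ k + A) := fun k => by
    obtain ⟨h3, h4⟩ := hr.integral_dualSup_error_le hH hS hSp hs hT hTp hg hf hx₀ hα hα1 hβ hβ1
      hη hc k
    have i1 : Integrable (fun ω => f (x k ω) - f (x (k + 1) ω)) μ :=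
      (hfint k).sub (hfint (k + 1))
    have i2 : Integrable (fun ω => f (x k ω) - f (x (k + 1) ω) +
        2 * η * dualSup H (m k ω - ∇ f (x k ω))) μ := i1.add (h3.const_mul _)
    have h5 : ∫ ω, η * criterion H D f (x k ω) ∂μ ≤ ∫ ω, (f (x k ω) - f (x (k + 1) ω) +
        2 * η * dualSup H (m k ω - ∇ f (x k ω)) + 2 * nuclearNorm L * η ^ 2) ∂μ :=
      integral_mono ((hcint k).const_mul η)
        (i2.add (integrable_const _)) fun ω =>
        hH.criterion_descent hL hLp hfL hD hβ hη hc (hr.mem_ball hH hx₀ hβ1 hc k ω)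
          (hr.x_feasible k ω) (hr.x_argmin k ω)
    rw [integral_add i2 (integrable_const _), integral_add i1 (h3.const_mul _),
      integral_sub (hfint k) (hfint (k + 1)), integral_const_mul, integral_const_mul,
      integral_const, probReal_univ, one_smul] at h5
    have h6 := mul_le_mul_of_nonneg_left h4 (by positivity : 0 ≤ 2 * η)
    refine h5.trans ?_
    rw [hA]
    have e : 2 * η * (2 * nuclearNorm T * η ^ 2 / α ^ 2) = 4 * nuclearNorm T * η ^ 3 / α ^ 2 := by
      ring
    linarith
  have hlast : optValue H D f ≤ ∫ ω, f (x K ω) ∂μ := by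
    have := integral_mono (integrable_const (μ := μ) (optValue H D f)) (hfint K)
      fun ω => optValue_le hb (hr.mem_ball hH hx₀ hβ1 hc K ω)
    simpa using this
  have hfirst : ∫ ω, f (x 0 ω) ∂μ = f x₀ := by simp [hr.x_zero]
  have hgeo := mul_le_mul_of_nonneg_left (sum_pow_one_sub_le hα hα1 K)
    (mul_nonneg (mul_nonneg zero_le_two hη) (nuclearNorm_nonneg S))
  calc _ = η * (K * ∫ ω, (⨅ k : Fin K, criterion H D f (x k ω)) ∂μ) := by ring
    _ ≤ η * ∑ k ∈ Finset.range K, ∫ ω, criterion H D f (x k ω) ∂μ :=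
        mul_le_mul_of_nonneg_left h2 hη
    _ ≤ ∑ k ∈ Finset.range K, (∫ ω, f (x k ω) ∂μ - ∫ ω, f (x (k + 1) ω) ∂μ +
        (2 * η * nuclearNorm S * (1 - α) ^ k + A)) := by
        rw [Finset.mul_sum]
        exact Finset.sum_le_sum fun k _ => hstep k
    _ = ∫ ω, f (x 0 ω) ∂μ - ∫ ω, f (x K ω) ∂μ +
        (2 * η * nuclearNorm S * ∑ k ∈ Finset.range K, (1 - α) ^ k + K * A) := by
        rw [Finset.sum_add_distrib, Finset.sum_add_distrib, ← Finset.mul_sum,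
          Finset.sum_range_sub' (fun k => ∫ ω, f (x k ω) ∂μ)]
        simp
    _ ≤ _ := by
        rw [mul_one_div] at hgeo
        linarith

/-- Unrolls a contraction with factor `1 - β`. The term `K (1-β)^(K-1)` is the convolution of the
contraction with the decaying initial noise, and `A / β` is the fixed point for the constant error.
-/
theorem IsRun.integral_sub_optValue_le (hr : IsRun H g 𝒟 α β η x₀ μ ℱ ξ x m)
    (hH : IsStructured H) (hL : L ∈ H) (hLp : IsPosDef L)
    (hS : S ∈ H) (hSp : IsPosDef S) (hs : 0 < nuclearNorm S) (hT : T ∈ H) (hTp : IsPosDef T)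
    (hfL : IsSmooth f L) (hg : IsGradientEstimator f g 𝒟 S) (hf : IsSecondOrderSmooth f T)
    (hconv : ConvexOn ℝ Set.univ f) (hD : D ≠ ⊤) (hx₀ : x₀ ∈ ball H D)
    (hα : 0 < α) (hα1 : α ≤ 1) (hβ : 0 < β) (hβα : β ≤ α) (hη : 0 ≤ η)
    (hc : Compatible D β η) (K : ℕ) :
    Integrable (fun ω => f (x K ω) - optValue H D f) μ ∧
    ∫ ω, (f (x K ω) - optValue H D f) ∂μ ≤
      (1 - β) ^ K * (f x₀ - optValue H D f) +
      2 * η * nuclearNorm S * (K * (1 - β) ^ (K - 1)) + (2 * η * nuclearNorm S * √α +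
        4 * nuclearNorm T * η ^ 3 / α ^ 2 + 2 * nuclearNorm L * η ^ 2) / β := by
  have hfc : Continuous f := hfL.contDiff.continuous
  have hβ1 : β ≤ 1 := hβα.trans hα1
  have hfint : ∀ k, Integrable (fun ω => f (x k ω) - optValue H D f) μ := fun k =>
    (hr.integrable_comp hH hx₀ hβ.le hβ1 hη hc k hfc).sub (integrable_const _)
  have ht := nuclearNorm_nonneg T
  have hl := nuclearNorm_nonneg L
  refine ⟨hfint K, ?_⟩
  set A := 2 * η * nuclearNorm S * √α +
        4 * nuclearNorm T * η ^ 3 / α ^ 2 + 2 * nuclearNorm L * η ^ 2 with hA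
  have hA0 : 0 ≤ A := by positivity
  have hstep : ∀ k, ∫ ω, (f (x (k + 1) ω) - optValue H D f) ∂μ ≤
      (1 - β) * ∫ ω, (f (x k ω) - optValue H D f) ∂μ +
        (2 * η * nuclearNorm S * (1 - β) ^ k + A) := fun k => by
    obtain ⟨h3, h4⟩ := hr.integral_dualSup_error_le hH hS hSp hs hT hTp hg hf hx₀ hα hα1 hβ.le hβ1
      hη hc k
    have i1 : Integrable (fun ω => (1 - β) * (f (x k ω) - optValue H D f) +
        2 * η * dualSup H (m k ω - ∇ f (x k ω))) μ :=
      ((hfint k).const_mul _).add (h3.const_mul _)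
    have h5 : ∫ ω, (f (x (k + 1) ω) - optValue H D f) ∂μ ≤
        ∫ ω, ((1 - β) * (f (x k ω) - optValue H D f) +
        2 * η * dualSup H (m k ω - ∇ f (x k ω)) + 2 * nuclearNorm L * η ^ 2) ∂μ :=
      integral_mono (hfint (k + 1))
        (i1.add (integrable_const _)) fun ω =>
        hH.convex_descent hL hLp hfL hconv hD hβ.le hη hc (hr.mem_ball hH hx₀ hβ1 hc k ω)
          (hr.x_feasible k ω) (hr.x_argmin k ω)
    rw [integral_add i1 (integrable_const _),
      integral_add ((hfint k).const_mul _) (h3.const_mul _),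
      integral_const_mul, integral_const_mul,
      integral_const, probReal_univ, one_smul] at h5
    have h6 := mul_le_mul_of_nonneg_left h4 (by positivity : 0 ≤ 2 * η)
    -- This is where `β ≤ α` enters: the initial noise is weakened to decay at the rate of the
    -- contraction.
    have h7 := mul_le_mul_of_nonneg_left
      (pow_le_pow_left₀ (sub_nonneg.2 hα1) (sub_le_sub_left hβα 1) k)
      (by positivity : 0 ≤ 2 * η * nuclearNorm S)
    refine h5.trans ?_
    rw [hA]
    have e : 2 * η * (2 * nuclearNorm T * η ^ 2 / α ^ 2) = 4 * nuclearNorm T * η ^ 3 / α ^ 2 := by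
      ring
    linarith
  induction K with
  | zero =>
    have : 0 ≤ A / β := by positivity
    simp [hr.x_zero, this]
  | succ k ih =>
    refine (hstep k).trans ?_
    have h1 := mul_le_mul_of_nonneg_left ih (sub_nonneg.2 hβ1)
    have h2 : (1 - β) * (A / β) + A = A / β := by
      field_simp
      ring
    -- For `k = 0` the truncated exponent is harmless because the factor `k` vanishes.
    have h3 : (1 - β) * (k * (1 - β) ^ (k - 1)) = k * (1 - β) ^ k := by
      rcases k with _ | k
      · simp
      · rw [Nat.add_sub_cancel, pow_succ]
        ring
    rw [Nat.add_sub_cancel, pow_succ]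
    push_cast
    have h4 : (1 - β) * ((1 - β) ^ k * (f x₀ - optValue H D f) +
        2 * η * nuclearNorm S * (k * (1 - β) ^ (k - 1)) + A / β) =
        (1 - β) ^ k * (1 - β) * (f x₀ - optValue H D f) +
        2 * η * nuclearNorm S * (k * (1 - β) ^ k) + (A / β - A) := by
      rw [mul_add, mul_add, mul_left_comm (1 - β) (2 * η * nuclearNorm S), h3]
      linarith
    rw [h4] at h1
    linarith

end Convergence

/-! ### Numerical verification of the parameter choices. -/

section ParameterBounds

theorem inv_min_le {a b : ℝ} (ha : 0 < a) (hb : 0 < b) : (min a b)⁻¹ ≤ a⁻¹ + b⁻¹ := by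
  rcases min_choice a b with h | h <;> rw [h]
  · exact le_add_of_nonneg_right (inv_pos.2 hb).le
  · exact le_add_of_nonneg_left (inv_pos.2 ha).le

theorem rpow_three_halves {a : ℝ} (ha : 0 < a) : a ^ (3 / 2 : ℝ) = a * √a := by
  rw [Real.sqrt_eq_rpow, ← Real.rpow_one_add' ha.le (by norm_num)]
  norm_num

theorem rpow_five_halves {a : ℝ} (ha : 0 < a) : a ^ (5 / 2 : ℝ) = a ^ 2 * √a := by
  rw [Real.sqrt_eq_rpow, ← Real.rpow_natCast, ← Real.rpow_add ha]
  norm_num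

theorem rpow_seven_halves {a : ℝ} (ha : 0 < a) : a ^ (7 / 2 : ℝ) = a ^ 3 * √a := by
  rw [Real.sqrt_eq_rpow, ← Real.rpow_natCast, ← Real.rpow_add ha]
  norm_num

/-- After division by `ηK`, the smoothness, second-order, noise, initial-noise and `Δ` terms are at
most `1/4`, `1/16`, `1/4`, `1/8` and `1/4` of `ε`, which sum to less than `ε`. Here `δ` stands for
`Δ/(εD)`, or zero if `D = ∞`. -/
theorem nonconvex_bound {ε l s t Δ δ M α η X K : ℝ} (hε : 0 < ε) (hl : 0 < l) (hs : 0 < s)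
    (ht : 0 < t) (hα : 0 < α) (hη : 0 < η) (hK : 4096 * M ≤ K)
    (hαinv : α⁻¹ ≤ 1 + 64 * (s ^ 2 / ε ^ 2)) (hαle : α ≤ 1 / 64 * (ε ^ 2 / s ^ 2))
    (hη1 : η ≤ 1 / 8 * (ε / l)) (hη2 : η ≤ 1 / 8 * (√ε * α / √t)) (hΔ : 0 ≤ Δ)
    (hηinv : Δ * η⁻¹ ≤ ε * δ + Δ * (8 * (l / ε) + 8 * (√t / √ε * α⁻¹)))
    (h1 : 1 ≤ M) (h2 : δ ≤ M) (h3 : l * Δ / ε ^ 2 ≤ M) (h4 : s ^ 3 / ε ^ 3 ≤ M)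
    (h5 : √t * Δ / (ε * √ε) ≤ M) (h6 : s ^ 2 * √t * Δ / (ε ^ 3 * √ε) ≤ M)
    (hX : η * K * X ≤ Δ + 2 * η * s / α + K * (2 * η * s * √α + 4 * t * η ^ 3 / α ^ 2 +
      2 * l * η ^ 2)) : X ≤ ε := by
  have hK0 : 0 < K := by linarith
  have hsε : 0 < √ε := Real.sqrt_pos.2 hε
  have hst : 0 < √t := Real.sqrt_pos.2 ht
  have b1 : 2 * l * η ≤ ε / 4 := by
    have := mul_le_mul_of_nonneg_left hη1 (by positivity : 0 ≤ 2 * l)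
    refine this.trans (le_of_eq ?_)
    field_simp
    norm_num
  have b2 : 4 * t * η ^ 2 / α ^ 2 ≤ ε / 16 := by
    have := pow_le_pow_left₀ hη.le hη2 2
    rw [mul_pow, div_pow (√ε * α), mul_pow √ε, Real.sq_sqrt hε.le, Real.sq_sqrt ht.le] at this
    rw [div_le_iff₀ (by positivity)]
    refine (mul_le_mul_of_nonneg_left this (by positivity : 0 ≤ 4 * t)).trans (le_of_eq ?_)
    field_simp
    norm_num
  have b3 : 2 * s * √α ≤ ε / 4 := by
    have : √α ≤ ε / (8 * s) := by
      refine Real.sqrt_le_iff.2 ⟨by positivity, hαle.trans (le_of_eq ?_)⟩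
      field_simp
      norm_num
    refine (mul_le_mul_of_nonneg_left this (by positivity : 0 ≤ 2 * s)).trans (le_of_eq ?_)
    field_simp
    norm_num
  have b4 : 2 * s * α⁻¹ ≤ K * (ε / 8) := by
    -- The ratio `s / ε` is not among the terms of the complexity, but it is at most the maximum of
    -- `1` and its cube.
    have hsM : s / ε ≤ M := by
      rcases le_or_gt (s / ε) 1 with h | h
      · exact h.trans h1
      · refine le_trans ?_ h4
        rw [← div_pow]
        exact le_self_pow₀ h.le (by norm_num)
    have e : 2 * s * (1 + 64 * (s ^ 2 / ε ^ 2)) =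
        ε * (2 * (s / ε) + 128 * (s ^ 3 / ε ^ 3)) := by
      field_simp
      ring
    calc 2 * s * α⁻¹ ≤ 2 * s * (1 + 64 * (s ^ 2 / ε ^ 2)) := by gcongr
      _ = ε * (2 * (s / ε) + 128 * (s ^ 3 / ε ^ 3)) := e
      _ ≤ ε * (2 * M + 128 * M) := by gcongr
      _ ≤ ε * (K / 8) := by
          refine mul_le_mul_of_nonneg_left ?_ hε.le
          linarith
      _ = _ := by ring
  have b5 : Δ * η⁻¹ ≤ K * (ε / 4) := by
    have e : Δ * (8 * (l / ε) + 8 * (√t / √ε * (1 + 64 * (s ^ 2 / ε ^ 2)))) =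
        ε * (8 * (l * Δ / ε ^ 2) + 8 * (√t * Δ / (ε * √ε)) +
          512 * (s ^ 2 * √t * Δ / (ε ^ 3 * √ε))) := by
      field_simp
      ring
    calc Δ * η⁻¹ ≤ ε * δ + Δ * (8 * (l / ε) + 8 * (√t / √ε * α⁻¹)) := hηinv
      _ ≤ ε * δ + Δ * (8 * (l / ε) + 8 * (√t / √ε * (1 + 64 * (s ^ 2 / ε ^ 2)))) := by gcongr
      _ = ε * δ + ε * (8 * (l * Δ / ε ^ 2) + 8 * (√t * Δ / (ε * √ε)) +
          512 * (s ^ 2 * √t * Δ / (ε ^ 3 * √ε))) := by rw [e]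
      _ ≤ ε * M + ε * (8 * M + 8 * M + 512 * M) := by gcongr
      _ ≤ ε * (K / 4) := by
          rw [← mul_add]
          refine mul_le_mul_of_nonneg_left ?_ hε.le
          linarith
      _ = _ := by ring
  have hηK : 0 < η * K := mul_pos hη hK0
  refine le_of_mul_le_mul_left (hX.trans ?_) hηK
  have e : Δ + 2 * η * s / α + K * (2 * η * s * √α + 4 * t * η ^ 3 / α ^ 2 + 2 * l * η ^ 2) =
      η * (Δ * η⁻¹ + 2 * s * α⁻¹ + K * (2 * s * √α + 4 * t * η ^ 2 / α ^ 2 + 2 * l * η)) := by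
    field_simp
  rw [e, mul_assoc η K]
  refine mul_le_mul_of_nonneg_left ?_ hη.le
  have := mul_le_mul_of_nonneg_left (add_le_add (add_le_add b3 b2) b1) hK0.le
  have hKε : 0 < K * ε := mul_pos hK0 hε
  linarith

/-- The stationary terms use `1/4 + 1/16 + 1/4` of `ε`. For the others, `K` forces `βK ≥ 16 log N`,
so even half of the exponent `βK` leaves a factor `N⁻⁸`, which beats the initial size `ε N`. -/
theorem convex_bound {ε l s t Δ D M α β η X : ℝ} {K : ℕ} (hε : 0 < ε) (hl : 0 < l) (hs : 0 < s)
    (ht : 0 < t) (hD : 0 < D) (hα : 0 < α) (hβ : 0 < β) (hβ1 : β ≤ 1) (hη : η = β * D)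
    (hK : 10000 * (M * Real.log (2 + Δ / ε + s * D / ε)) ≤ K)
    (hαinv : α⁻¹ ≤ 1 + 64 * (s ^ 2 * D ^ 2 / ε ^ 2))
    (hαle : α ≤ 1 / 64 * (ε ^ 2 / (s ^ 2 * D ^ 2)))
    (hβ2 : β ≤ 1 / 8 * (ε / (l * D ^ 2))) (hβ3 : β ≤ 1 / 8 * (√ε * α / √(t * D ^ 3)))
    (hΔ : 0 ≤ Δ)
    (hβinv : β⁻¹ ≤ α⁻¹ + 8 * (l * D ^ 2 / ε) + 8 * (√(t * D ^ 3) / √ε * α⁻¹))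
    (h1 : 1 ≤ M) (h2 : l * D ^ 2 / ε ≤ M) (h3 : s ^ 2 * D ^ 2 / ε ^ 2 ≤ M)
    (h4 : √t * (D * √D) / √ε ≤ M) (h5 : s ^ 2 * √t * (D ^ 3 * √D) / (ε ^ 2 * √ε) ≤ M)
    (hX : X ≤ (1 - β) ^ K * Δ + 2 * η * s * (K * (1 - β) ^ (K - 1)) +
      (2 * η * s * √α + 4 * t * η ^ 3 / α ^ 2 + 2 * l * η ^ 2) / β) : X ≤ ε := by
  have hsε : 0 < √ε := Real.sqrt_pos.2 hε
  have hsqrt : √(t * D ^ 3) = √t * (D * √D) := by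
    rw [Real.sqrt_mul ht.le, show D ^ 3 = D ^ 2 * D by ring, Real.sqrt_mul (sq_nonneg D),
      Real.sqrt_sq hD.le]
  have b1 : 2 * l * (β * D ^ 2) ≤ ε / 4 := by
    have := mul_le_mul_of_nonneg_left hβ2 (by positivity : 0 ≤ 2 * l * D ^ 2)
    refine (by linarith : _ ≤ 2 * l * D ^ 2 * (1 / 8 * (ε / (l * D ^ 2)))).trans (le_of_eq ?_)
    field_simp
    norm_num
  have b2 : 4 * t * (β ^ 2 * D ^ 3) / α ^ 2 ≤ ε / 16 := by
    have := pow_le_pow_left₀ hβ.le hβ3 2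
    rw [mul_pow, div_pow (√ε * α), mul_pow √ε, Real.sq_sqrt hε.le, Real.sq_sqrt (by positivity)] at this
    rw [div_le_iff₀ (by positivity)]
    have h := mul_le_mul_of_nonneg_left this (by positivity : 0 ≤ 4 * t * D ^ 3)
    refine (by linarith : _ ≤ 4 * t * D ^ 3 * ((1 / 8) ^ 2 * (ε * α ^ 2 / (t * D ^ 3)))).trans
      (le_of_eq ?_)
    field_simp
    norm_num
  have b3 : 2 * (s * D) * √α ≤ ε / 4 := by
    have : √α ≤ ε / (8 * (s * D)) := by
      refine Real.sqrt_le_iff.2 ⟨by positivity, hαle.trans (le_of_eq ?_)⟩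
      field_simp
      norm_num
    refine (mul_le_mul_of_nonneg_left this (by positivity : 0 ≤ 2 * (s * D))).trans (le_of_eq ?_)
    field_simp
    norm_num
  -- `593 = 65 + 8 + 8 · 65`, from `α⁻¹ ≤ 65 M` and the two remaining terms of `hβinv`.
  have hβM : β⁻¹ ≤ 593 * M := by
    have e : √(t * D ^ 3) / √ε * (1 + 64 * (s ^ 2 * D ^ 2 / ε ^ 2)) =
        √t * (D * √D) / √ε + 64 * (s ^ 2 * √t * (D ^ 3 * √D) / (ε ^ 2 * √ε)) := by
      rw [hsqrt]
      field_simp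
    have := mul_le_mul_of_nonneg_left hαinv (by positivity : 0 ≤ √(t * D ^ 3) / √ε)
    linarith
  set N := 2 + Δ / ε + s * D / ε with hN
  have hΔε : 0 ≤ Δ / ε := by positivity
  have hsDε : 0 ≤ s * D / ε := by positivity
  have hN2 : 2 ≤ N := by linarith
  have hN0 : 0 < N := by linarith
  have hlog : 0 ≤ Real.log N := Real.log_nonneg (by linarith)
  -- The constant `10000` suffices because `16 · 593 = 9488`.
  have hβK : 16 * Real.log N ≤ β * K := by
    rw [inv_le_iff_one_le_mul₀ hβ] at hβM
    have h6 := mul_le_mul_of_nonneg_left hK hβ.le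
    have h7 := mul_le_mul_of_nonneg_right hβM hlog
    have h8 : 0 ≤ β * (M * Real.log N) := by positivity
    linarith
  have hexp : ∀ n : ℕ, (1 - β) ^ n ≤ Real.exp (-(β * n)) := fun n => by
    rw [show -(β * n) = n * (-β) by ring, Real.exp_nat_mul]
    exact pow_le_pow_left₀ (sub_nonneg.2 hβ1) (by linarith [Real.add_one_le_exp (-β)]) n
  have hexp8 : Real.exp (-(β * K / 2)) ≤ (N ^ 8)⁻¹ := by
    have : N ^ 8 = Real.exp (8 * Real.log N) := by
      rw [show (8 : ℝ) * Real.log N = (8 : ℕ) * Real.log N by norm_num, Real.exp_nat_mul,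
        Real.exp_log hN0]
    rw [this, ← Real.exp_neg]
    exact Real.exp_le_exp.2 (by linarith)
  have hN7 : N * (N ^ 8)⁻¹ ≤ 1 / 128 := by
    have : N * (N ^ 8)⁻¹ = 1 / N ^ 7 := by field_simp
    rw [this]
    refine one_div_le_one_div_of_le (by norm_num) ?_
    calc (128 : ℝ) = 2 ^ 7 := by norm_num
      _ ≤ N ^ 7 := pow_le_pow_left₀ (by norm_num) hN2 7
  have hβK0 : 0 ≤ β * K := by positivity
  have b4 : (1 - β) ^ K * Δ ≤ ε / 128 := by
    have hΔN : Δ ≤ ε * N := by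
      have : ε * (Δ / ε) ≤ ε * N := mul_le_mul_of_nonneg_left (by linarith) hε.le
      rwa [mul_div_cancel₀ _ hε.ne'] at this
    calc (1 - β) ^ K * Δ ≤ Real.exp (-(β * K / 2)) * Δ := by
          refine mul_le_mul_of_nonneg_right ((hexp K).trans (Real.exp_le_exp.2 ?_)) hΔ
          linarith
      _ ≤ (N ^ 8)⁻¹ * (ε * N) := by gcongr
      _ = ε * (N * (N ^ 8)⁻¹) := by ring
      _ ≤ ε * (1 / 128) := by gcongr
      _ = _ := by ring
  have b5 : 2 * η * s * (K * (1 - β) ^ (K - 1)) ≤ 6 * ε / 128 := by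
    have hsN : s * D ≤ ε * N := by
      have : ε * (s * D / ε) ≤ ε * N := mul_le_mul_of_nonneg_left (by linarith) hε.le
      rwa [mul_div_cancel₀ _ hε.ne'] at this
    have hKpos : 1 ≤ K := by
      have hlogpos : 0 < Real.log N := Real.log_pos (by linarith)
      rcases Nat.eq_zero_or_pos K with h | h
      · rw [h] at hβK
        simp at hβK
        linarith
      · exact h
    -- The missing factor costs `exp β ≤ e < 3`.
    have e1 : (1 - β) ^ (K - 1) ≤ 3 * Real.exp (-(β * K)) := by
      refine (hexp (K - 1)).trans ?_
      rw [Nat.cast_sub hKpos, show -(β * ((K : ℝ) - (1 : ℕ))) = β + -(β * K) by push_cast; ring,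
        Real.exp_add]
      refine mul_le_mul_of_nonneg_right ?_ (Real.exp_pos _).le
      exact (Real.exp_le_exp.2 hβ1).trans (by linarith [Real.exp_one_lt_d9])
    -- Half of the exponential decay is spent on the linear factor `βK`.
    have e2 : β * K ≤ Real.exp (β * K / 2) := by
      have := Real.quadratic_le_exp_of_nonneg (by positivity : 0 ≤ β * K / 2)
      nlinarith [sq_nonneg (β * K - 2)]
    have e3 : β * K * Real.exp (-(β * K)) ≤ Real.exp (-(β * K / 2)) := by
      refine (mul_le_mul_of_nonneg_right e2 (Real.exp_pos _).le).trans (le_of_eq ?_)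
      rw [← Real.exp_add]
      congr 1
      ring
    calc 2 * η * s * (K * (1 - β) ^ (K - 1))
        ≤ 2 * η * s * (K * (3 * Real.exp (-(β * K)))) := by
          rw [hη]
          gcongr
      _ = 6 * (s * D) * (β * K * Real.exp (-(β * K))) := by
          rw [hη]
          ring
      _ ≤ 6 * (ε * N) * (N ^ 8)⁻¹ := by
          gcongr
          exact e3.trans hexp8
      _ = 6 * ε * (N * (N ^ 8)⁻¹) := by ring
      _ ≤ 6 * ε * (1 / 128) := by gcongr
      _ = _ := by ring
  have e : (2 * η * s * √α + 4 * t * η ^ 3 / α ^ 2 + 2 * l * η ^ 2) / β =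
      2 * (s * D) * √α + 4 * t * (β ^ 2 * D ^ 3) / α ^ 2 + 2 * l * (β * D ^ 2) := by
    rw [hη]
    field_simp
  rw [e] at hX
  linarith

end ParameterBounds

/-! ### Substitution of the parameters, and the zero-dimensional case. -/

section Complexity

variable {E : Type*} [NormedAddCommGroup E] [InnerProductSpace ℝ E] [FiniteDimensional ℝ E]
  [MeasurableSpace E] [BorelSpace E] {H : Submodule ℝ (E →L[ℝ] E)} {L S T : E →L[ℝ] E}
  {Ξ : Type*} [MeasurableSpace Ξ] {𝒟 : Measure Ξ} [IsProbabilityMeasure 𝒟]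
  {f : E → ℝ} {g : E → Ξ → E} {Ω : Type*} {mΩ : MeasurableSpace Ω} {μ : Measure Ω}
  [IsProbabilityMeasure μ] {α β η : ℝ} {x₀ : E} {ℱ : Filtration ℕ mΩ} {ξ : ℕ → Ω → Ξ}
  {x m : ℕ → Ω → E} {D : ℝ≥0∞}

theorem criterion_of_subsingleton [Subsingleton E] (hH : IsStructured H) (hD : 0 < D) (y : E) :
    criterion H D f y = 0 := by
  have h0 : ∇ f y = 0 := Subsingleton.elim _ _
  by_cases h : D = ⊤
  · rw [criterion, if_pos h, hH.dualNorm_eq, h0, hH.dualSup_zero]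
  · rw [hH.criterion_eq hD h, h0, hH.dualSup_zero]
    simp

theorem optValue_of_subsingleton [Subsingleton E] (hx₀ : x₀ ∈ ball H D) (y : E) :
    optValue H D f = f y := by
  have : f '' ball H D = {f y} := by
    ext z
    constructor
    · rintro ⟨w, -, rfl⟩
      rw [Subsingleton.elim w y]
      rfl
    · rintro rfl
      exact ⟨x₀, hx₀, by rw [Subsingleton.elim x₀ y]⟩
  rw [optValue, this, csInf_singleton]

theorem inv_min_one_le {a : ℝ} (ha : 0 < a) : (min 1 (1 / 64 * a))⁻¹ ≤ 1 + 64 * a⁻¹ := by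
  refine (inv_min_le one_pos (by positivity)).trans (le_of_eq ?_)
  rw [mul_inv]
  norm_num

theorem IsRun.integral_iInf_criterion_le_eps
    (hH : IsStructured H) (hL : L ∈ H) (hLp : IsPosDef L)
    (hS : S ∈ H) (hSp : IsPosDef S) (hT : T ∈ H) (hTp : IsPosDef T)
    (hfL : IsSmooth f L) (hg : IsGradientEstimator f g 𝒟 S) (hf : IsSecondOrderSmooth f T)
    (hD : 0 < D) (hb : BddBelow (f '' ball H D)) (hx₀ : x₀ ∈ ball H D) {ε : ℝ} (hε : 0 < ε)
    (hα : α = momentum (1 / 64) ε (nuclearNorm S))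
    (hβ : β = weightDecay (1 / 8) (1 / 8) ε (nuclearNorm L) (nuclearNorm T) α D)
    (hη : η = stepsize (1 / 8) (1 / 8) ε (nuclearNorm L) (nuclearNorm T) α D)
    (hr : IsRun H g 𝒟 α β η x₀ μ ℱ ξ x m) {K : ℕ}
    (hK : 4096 * complexity ε (nuclearNorm L) (nuclearNorm S) (nuclearNorm T)
      (f x₀ - optValue H D f) D ≤ K) :
    Integrable (fun ω => ⨅ k : Fin K, criterion H D f (x k ω)) μ ∧
    ∫ ω, (⨅ k : Fin K, criterion H D f (x k ω)) ∂μ ≤ ε := by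
  -- On the zero space all trace norms vanish and the parameters degenerate through division by
  -- zero, so this case is settled directly.
  rcases subsingleton_or_nontrivial E with hE | hE
  · simp only [criterion_of_subsingleton hH hD]
    simp [hε.le]
  have hl := hLp.nuclearNorm_pos
  have hs := hSp.nuclearNorm_pos
  have ht := hTp.nuclearNorm_pos
  have hΔ : 0 ≤ f x₀ - optValue H D f := sub_nonneg.2 (optValue_le hb hx₀)
  set l := nuclearNorm L
  set s := nuclearNorm S
  set t := nuclearNorm T
  set Δ := f x₀ - optValue H D f
  have hα0 : 0 < α := by
    rw [hα, momentum]
    positivity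
  have hα1 : α ≤ 1 := hα ▸ min_le_left _ _
  have hαle : α ≤ 1 / 64 * (ε ^ 2 / s ^ 2) := hα ▸ min_le_right _ _
  have hαinv : α⁻¹ ≤ 1 + 64 * (s ^ 2 / ε ^ 2) := by
    rw [hα, momentum]
    refine (inv_min_one_le (by positivity)).trans (le_of_eq ?_)
    rw [inv_div]
  have hsε : 0 < √ε := Real.sqrt_pos.2 hε
  have hst : 0 < √t := Real.sqrt_pos.2 ht
  set η₀ := min (1 / 8 * (ε / l)) (1 / 8 * (√ε * α / √t)) with hη₀
  have hη₀pos : 0 < η₀ := by positivity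
  have hη₀inv : η₀⁻¹ ≤ 8 * (l / ε) + 8 * (√t / √ε * α⁻¹) := by
    refine (inv_min_le (by positivity) (by positivity)).trans (le_of_eq ?_)
    field_simp
  have hβη : 0 ≤ β ∧ β ≤ 1 ∧ Compatible D β η ∧ 0 < η ∧ η ≤ η₀ ∧
      Δ * η⁻¹ ≤ ε * (if D = ⊤ then 0 else Δ / (ε * D.toReal)) + Δ * η₀⁻¹ := by
    by_cases h : D = ⊤
    · rw [weightDecay, if_pos h] at hβ
      rw [stepsize, if_pos h] at hη
      rw [← hη₀] at hη
      simp [Compatible, hβ, hη, h, hη₀pos]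
    · have hD' : 0 < D.toReal := ENNReal.toReal_pos hD.ne' h
      -- For finite `D` the stepsize is the unconstrained stepsize `η₀` capped at `D`; hence `1/η ≤
      -- 1/D + 1/η₀`, and `1/D` accounts for the term `Δ₀/(εD)`.
      have hη' : η = min D.toReal η₀ := by
        rw [hη, stepsize, if_neg h, weightDecay, if_neg h, min_mul_of_nonneg _ _ hD'.le,
          min_mul_of_nonneg _ _ hD'.le, one_mul, hη₀]
        congr 2 <;> field_simp
      rw [weightDecay, if_neg h] at hβ
      refine ⟨hβ ▸ by positivity, hβ ▸ min_le_left _ _, ?_, hη' ▸ lt_min hD' hη₀pos,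
        hη' ▸ min_le_right _ _, ?_⟩
      · rw [Compatible, if_neg h, hη, stepsize, if_neg h, weightDecay, if_neg h, hβ]
      · rw [if_neg h, hη']
        refine (mul_le_mul_of_nonneg_left (inv_min_le hD' hη₀pos) hΔ).trans (le_of_eq ?_)
        field_simp
  obtain ⟨hβ0, hβ1, hc, hη0, hηle, hηinv⟩ := hβη
  have hM : ∀ {a b c d e p q : ℝ}, p = max 1 (max a (max b (max c (max d e)))) → p ≤ q →
      1 ≤ q ∧ a ≤ q ∧ b ≤ q ∧ c ≤ q ∧ d ≤ q ∧ e ≤ q := fun {a b c d e p q} h1 h2 => by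
    rw [h1] at h2
    simpa only [max_le_iff] using h2
  obtain ⟨m1, m2, m3, m4, m5, m6⟩ := hM (complexity.eq_1 ε l s t Δ D) le_rfl
  rw [rpow_three_halves hε] at m5
  rw [rpow_seven_halves hε] at m6
  have hK0 : 0 < K := by
    have : (0 : ℝ) < K := by linarith
    exact_mod_cast this
  obtain ⟨h1, h2⟩ := hr.integral_iInf_criterion_le hH hL hLp hS hSp hs hT hTp hfL hg hf hD hb hx₀
    hα0 hα1 hβ0 hβ1 hη0.le hc hK0
  refine ⟨h1, nonconvex_bound hε hl hs ht hα0 hη0 hK hαinv hαle (hηle.trans (min_le_left _ _))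
    (hηle.trans (min_le_right _ _)) hΔ (hηinv.trans ?_) m1 m2 m3 m4 m5 m6 h2⟩
  gcongr

theorem IsRun.integral_sub_optValue_le_eps
    (hH : IsStructured H) (hL : L ∈ H) (hLp : IsPosDef L)
    (hS : S ∈ H) (hSp : IsPosDef S) (hT : T ∈ H) (hTp : IsPosDef T)
    (hfL : IsSmooth f L) (hg : IsGradientEstimator f g 𝒟 S) (hf : IsSecondOrderSmooth f T)
    (hD0 : 0 < D) (hb : BddBelow (f '' ball H D)) (hx₀ : x₀ ∈ ball H D) {ε : ℝ} (hε : 0 < ε)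
    (hconv : ConvexOn ℝ Set.univ f) (hD : D ≠ ⊤)
    (hα : α = momentumConvex (1 / 64) ε (nuclearNorm S) D.toReal)
    (hβ : β = weightDecayConvex (1 / 8) (1 / 8) ε (nuclearNorm L) (nuclearNorm T) α D.toReal)
    (hη : η = β * D.toReal)
    (hr : IsRun H g 𝒟 α β η x₀ μ ℱ ξ x m) {K : ℕ}
    (hK : 10000 * (complexityConvex ε (nuclearNorm L) (nuclearNorm S) (nuclearNorm T) D.toReal *
      logFactor ε (nuclearNorm S) (f x₀ - optValue H D f) D.toReal) ≤ K) :
    Integrable (fun ω => f (x K ω) - optValue H D f) μ ∧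
    ∫ ω, (f (x K ω) - optValue H D f) ∂μ ≤ ε := by
  rcases subsingleton_or_nontrivial E with hE | hE
  · simp [← optValue_of_subsingleton (f := f) hx₀, hε.le]
  have hl := hLp.nuclearNorm_pos
  have hs := hSp.nuclearNorm_pos
  have ht := hTp.nuclearNorm_pos
  have hΔ : 0 ≤ f x₀ - optValue H D f := sub_nonneg.2 (optValue_le hb hx₀)
  set l := nuclearNorm L
  set s := nuclearNorm S
  set t := nuclearNorm T
  set Δ := f x₀ - optValue H D f
  have hD' : 0 < D.toReal := ENNReal.toReal_pos hD0.ne' hD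
  set d := D.toReal
  have hα0 : 0 < α := by
    rw [hα, momentumConvex]
    positivity
  have hα1 : α ≤ 1 := hα ▸ min_le_left _ _
  have hαle : α ≤ 1 / 64 * (ε ^ 2 / (s ^ 2 * d ^ 2)) := hα ▸ min_le_right _ _
  have hαinv : α⁻¹ ≤ 1 + 64 * (s ^ 2 * d ^ 2 / ε ^ 2) := by
    rw [hα, momentumConvex]
    refine (inv_min_one_le (by positivity)).trans (le_of_eq ?_)
    rw [inv_div]
  have hsε : 0 < √ε := Real.sqrt_pos.2 hε
  have hst : 0 < √(t * d ^ 3) := Real.sqrt_pos.2 (by positivity)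
  rw [weightDecayConvex] at hβ
  have hβ0 : 0 < β := hβ ▸ by positivity
  have hβα : β ≤ α := hβ ▸ min_le_left _ _
  have hβ2 : β ≤ 1 / 8 * (ε / (l * d ^ 2)) :=
    hβ.le.trans ((min_le_right _ _).trans (min_le_left _ _))
  have hβ3 : β ≤ 1 / 8 * (√ε * α / √(t * d ^ 3)) :=
    hβ.le.trans ((min_le_right _ _).trans (min_le_right _ _))
  have hβinv : β⁻¹ ≤ α⁻¹ + 8 * (l * d ^ 2 / ε) + 8 * (√(t * d ^ 3) / √ε * α⁻¹) := by
    rw [hβ]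
    refine (inv_min_le hα0 (by positivity)).trans ?_
    rw [add_assoc]
    gcongr
    refine (inv_min_le (by positivity) (by positivity)).trans (le_of_eq ?_)
    field_simp
  have hc : Compatible D β η := by rwa [Compatible, if_neg hD]
  have hη0 : 0 ≤ η := hη ▸ by positivity
  have hM : ∀ {a b c e p q : ℝ}, p = max 1 (max a (max b (max c e))) → p ≤ q →
      1 ≤ q ∧ a ≤ q ∧ b ≤ q ∧ c ≤ q ∧ e ≤ q := fun {a b c e p q} h1 h2 => by
    rw [h1] at h2
    simpa only [max_le_iff] using h2
  obtain ⟨m1, m2, m3, m4, m5⟩ := hM (complexityConvex.eq_1 ε l s t d) le_rfl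
  rw [rpow_three_halves hD'] at m4
  rw [rpow_seven_halves hD', rpow_five_halves hε] at m5
  obtain ⟨h1, h2⟩ := hr.integral_sub_optValue_le hH hL hLp hS hSp hs hT hTp hfL hg hf hconv hD hx₀
    hα0 hα1 hβ0 hβα hη0 hc K
  exact ⟨h1, convex_bound hε hl hs ht hD' hα0 hβ0 (hβα.trans hα1) hη hK hαinv hαle hβ2 hβ3 hΔ
    hβinv m1 m2 m3 m4 m5 h2⟩

end Complexity

end NonEuclideanSGD

theorem mainTheorem2 :
    ∃ c₁ c₂ c₃ C : ℝ, (0 < c₁ ∧ 0 < c₂ ∧ 0 < c₃ ∧ 0 < C) ∧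
    ∃ c₁' c₂' c₃' C' : ℝ, (0 < c₁' ∧ 0 < c₂' ∧ 0 < c₃' ∧ 0 < C') ∧
    ∀ (E : Type*) [NormedAddCommGroup E] [InnerProductSpace ℝ E] [FiniteDimensional ℝ E]
      [MeasurableSpace E] [BorelSpace E]
      (H : Submodule ℝ (E →L[ℝ] E)) (_ : NonEuclideanSGD.IsStructured H)
      (L S T : E →L[ℝ] E)
      (_ : L ∈ H ∧ NonEuclideanSGD.IsPosDef L)
      (_ : S ∈ H ∧ NonEuclideanSGD.IsPosDef S)
      (_ : T ∈ H ∧ NonEuclideanSGD.IsPosDef T)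
      (Ξ : Type*) [MeasurableSpace Ξ] (𝒟 : Measure Ξ) [IsProbabilityMeasure 𝒟]
      (f : E → ℝ) (g : E → Ξ → E)
      (_ : NonEuclideanSGD.IsSmooth f L)
      (_ : NonEuclideanSGD.IsGradientEstimator f g 𝒟 S)
      (_ : NonEuclideanSGD.IsSecondOrderSmooth f T)
      (D : ℝ≥0∞) (_ : 0 < D) (_ : BddBelow (f '' NonEuclideanSGD.ball H D))
      (x₀ : E) (_ : x₀ ∈ NonEuclideanSGD.ball H D)
      (Ω : Type*) (mΩ : MeasurableSpace Ω) (μ : Measure Ω) [IsProbabilityMeasure μ]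
      (ℱ : Filtration ℕ mΩ) (ξ : ℕ → Ω → Ξ) (x m : ℕ → Ω → E)
      (ε l s t Δ₀ : ℝ) (_ : 0 < ε)
      (_ : l = NonEuclideanSGD.nuclearNorm L) (_ : s = NonEuclideanSGD.nuclearNorm S)
      (_ : t = NonEuclideanSGD.nuclearNorm T)
      (_ : Δ₀ = f x₀ - NonEuclideanSGD.optValue H D f),
      -- the non-convex case, constrained or unconstrained
      (∀ (α β η : ℝ) (K : ℕ),
        α = NonEuclideanSGD.momentum c₁ ε s →
        β = NonEuclideanSGD.weightDecay c₂ c₃ ε l t α D →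
        η = NonEuclideanSGD.stepsize c₂ c₃ ε l t α D →
        NonEuclideanSGD.IsRun H g 𝒟 α β η x₀ μ ℱ ξ x m →
        C * NonEuclideanSGD.complexity ε l s t Δ₀ D ≤ K →
        Integrable (fun ω => ⨅ k : Fin K, NonEuclideanSGD.criterion H D f (x k ω)) μ ∧
        ∫ ω, (⨅ k : Fin K, NonEuclideanSGD.criterion H D f (x k ω)) ∂μ ≤ ε) ∧
      -- the convex constrained case
      (ConvexOn ℝ Set.univ f → D ≠ ⊤ → ∀ (α β η : ℝ) (K : ℕ),
        α = NonEuclideanSGD.momentumConvex c₁' ε s D.toReal →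
        β = NonEuclideanSGD.weightDecayConvex c₂' c₃' ε l t α D.toReal →
        η = β * D.toReal →
        NonEuclideanSGD.IsRun H g 𝒟 α β η x₀ μ ℱ ξ x m →
        C' * (NonEuclideanSGD.complexityConvex ε l s t D.toReal *
          NonEuclideanSGD.logFactor ε s Δ₀ D.toReal) ≤ K →
        Integrable (fun ω => f (x K ω) - NonEuclideanSGD.optValue H D f) μ ∧
        ∫ ω, (f (x K ω) - NonEuclideanSGD.optValue H D f) ∂μ ≤ ε) := by
  -- `1/64 = (1/8)²` gives `√α ≤ ε/(8‖Σ‖_tr)`, with an extra factor `1/D` in the convex case. The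
  -- constants `4096` and `10000` are those of `nonconvex_bound` and `convex_bound`.
  refine ⟨1 / 64, 1 / 8, 1 / 8, 4096, by norm_num, 1 / 64, 1 / 8, 1 / 8, 10000, by norm_num, ?_⟩
  intro E _ _ _ _ _ H hH L S T hL hS hT Ξ _ 𝒟 _ f g hfL hg hf D hD hb x₀ hx₀ Ω mΩ μ _ ℱ ξ x m
    ε l s t Δ₀ hε hl hs ht hΔ
  subst hl hs ht hΔ
  exact ⟨fun α β η K hα hβ hη hr hK => hr.integral_iInf_criterion_le_eps hH hL.1 hL.2 hS.1 hS.2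
      hT.1 hT.2 hfL hg hf hD hb hx₀ hε hα hβ hη hK,
    fun hconv hD' α β η K hα hβ hη hr hK => hr.integral_sub_optValue_le_eps hH hL.1 hL.2 hS.1
      hS.2 hT.1 hT.2 hfL hg hf hD hb hx₀ hε hconv hD' hα hβ hη hK⟩
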